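/- Let $p:\mathbb Z\to[0,\infty)$ satisfy $p(z)=0$ for $|z|\neq 1$, $p(1)+p(-1)=1$ and $b:=\sum_z z\,p(z)=p(1)-p(-1)\neq 0$. Consider the nearest-neighbor asymmetric exclusion process $\eta(t)$, $t\ge 0$, with jump law $p$: the $\{0,1\}^{\mathbb Z}$-valued process with right-continuous paths having left limits whose generator acts on functions $f$ of finitely many coordinates by $$Lf(\eta)=\sum_{x,z\in\mathbb Z}p(z)\,\eta_x(1-\eta_{x+z})\bigl(f(\eta^{x,x+z})-f(\eta)\bigr),$$ where $\eta^{x,y}$ is $\eta$ with the values at $x$ and $y$ interchanged; that is, $f(\eta(t))-f(\eta(0))-\int_0^tLf(\eta(s))\,ds$ is a martingale for every such $f$. Let $\rho\in(0,1)$ and let the process start from the Bernoulli product measure $\pi_\rho$ under which the $\eta_x(0)$, $x\in\mathbb Z$, are independent with $\pi_\rho(\eta_x=1)=\rho$. Put $\chi=\rho(1-\rho)$, $$S(x,t)=E\bigl[(\eta_x(t)-\rho)(\eta_0(0)-\rho)\bigr],\qquad D(t)=(\chi t)^{-1}\sum_{x\in\mathbb Z}\bigl(x-(1-2\rho)bt\bigr)^2S(x,t)\quad(t>0).$$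 Then for every $t\ge0$ the series $\sum_{x}\bigl(x-(1-2\rho)bt\bigr)^2S(x,t)$ converges absolutely, and $t\mapsto tD(t)$ is non-decreasing on $[0,\infty)$ (with $tD(t)$ taken to be $0$ at $t=0$). -/

import Mathlib

open MeasureTheory ProbabilityTheory Filter Topology
open scoped NNReal

namespace ExclusionProcess

/-- Particle configurations on `ℤ`: `η x = true` means that the site `x` is occupied. The space
carries the product topology and the product sigma-algebra. -/
abbrev Config : Type := ℤ → Bool

/-- The occupation variable `η_x ∈ {0, 1}`. -/
def occ (η : Config) (x : ℤ) : ℝ := if η x = true then 1 else 0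

/-- The configuration `η^{x,y}`, in which the occupation variables at `x` and `y` are
interchanged. -/
def exchange (η : Config) (x y : ℤ) : Config := fun u => η (Equiv.swap x y u)

/-- A finite-range jump law on `ℤ`. -/
structure IsJumpLaw (p : ℤ → ℝ) : Prop where
  nonneg : ∀ z, 0 ≤ p z
  finite_range : ∃ R : ℤ, ∀ z, R < |z| → p z = 0
  sum_eq_one : ∑' z, p z = 1

/-- The drift `b = ∑_z z p(z)`. -/
noncomputable def drift (p : ℤ → ℝ) : ℝ := ∑' z : ℤ, (z : ℝ) * p z

/-- A local function: one that depends on finitely many occupation variables only. -/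
def IsLocal (f : Config → ℝ) : Prop := ∃ A : Finset ℤ, DependsOn f (A : Set ℤ)

/-- The generator `L f(η) = ∑_{x,z} p(z) η_x (1 - η_{x+z}) (f(η^{x,x+z}) - f(η))`; for a local
function `f` and a finite-range `p` only finitely many terms are nonzero. -/
noncomputable def generator (p : ℤ → ℝ) (f : Config → ℝ) (η : Config) : ℝ :=
  ∑' q : ℤ × ℤ, p q.2 * occ η q.1 * (1 - occ η (q.1 + q.2)) *
    (f (exchange η q.1 (q.1 + q.2)) - f η)

/-- The Bernoulli product measure `π_ρ` on configurations, under which every site is occupied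
with probability `ρ`, independently of the others. -/
noncomputable def bernoulliProduct (ρ : unitInterval) : Measure Config :=
  Measure.infinitePi fun _ : ℤ => bernoulliMeasure true false ρ

/-- `η` is, on the probability space `(Ω, P)` and with respect to the filtration `ℱ`, an exclusion
process with jump law `p`: a process with right-continuous paths that have left limits, adapted
to `ℱ`, that solves the martingale problem of the generator on local functions. -/
structure IsExclusionProcess {Ω : Type*} [MeasurableSpace Ω] (P : Measure Ω)
    (ℱ : Filtration ℝ≥0 (inferInstance : MeasurableSpace Ω)) (p : ℤ → ℝ)
    (η : ℝ≥0 → Ω → Config) : Prop where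
  adapted : ∀ t, Measurable[ℱ t] (η t)
  right_continuous : ∀ ω t, ContinuousWithinAt (fun s => η s ω) (Set.Ici t) t
  left_limits : ∀ ω t, ∃ ξ : Config, Tendsto (fun s => η s ω) (𝓝[<] t) (𝓝 ξ)
  martingale : ∀ f : Config → ℝ, IsLocal f →
    Martingale (fun t ω => f (η t ω) - f (η 0 ω) -
      ∫ s in (0 : ℝ)..(t : ℝ), generator p f (η s.toNNReal ω)) ℱ P

/-- The exclusion process with jump law `p` that is started from `π_ρ`. -/
structure IsStationaryExclusion {Ω : Type*} [MeasurableSpace Ω] (P : Measure Ω)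
    (ℱ : Filtration ℝ≥0 (inferInstance : MeasurableSpace Ω)) (p : ℤ → ℝ) (ρ : unitInterval)
    (η : ℝ≥0 → Ω → Config) : Prop extends IsExclusionProcess P ℱ p η where
  initial_law : P.map (η 0) = bernoulliProduct ρ

/-- The two-point function `S(x,t) = E[(η_x(t) - ρ) (η_0(0) - ρ)]`. -/
noncomputable def twoPoint {Ω : Type*} [MeasurableSpace Ω] (P : Measure Ω) (ρ : ℝ)
    (η : ℝ≥0 → Ω → Config) (x : ℤ) (t : ℝ≥0) : ℝ :=
  ∫ ω, (occ (η t ω) x - ρ) * (occ (η 0 ω) 0 - ρ) ∂P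

/-- The diffusivity `D(t) = (χ t)⁻¹ ∑_x (x - (1 - 2 ρ) b t)² S(x,t)`, where `χ = ρ (1 - ρ)`. -/
noncomputable def diffusivity {Ω : Type*} [MeasurableSpace Ω] (P : Measure Ω) (p : ℤ → ℝ) (ρ : ℝ)
    (η : ℝ≥0 → Ω → Config) (t : ℝ≥0) : ℝ :=
  (ρ * (1 - ρ) * t)⁻¹ * ∑' x : ℤ, ((x : ℝ) - (1 - 2 * ρ) * drift p * t) ^ 2 * twoPoint P ρ η x t

end ExclusionProcess

/-! Write P = p(1), Q = p(-1), b = P - Q, v = (1 - 2ρ)b, c_x = η_x - ρ and V(t) = ∑ (x - vt)²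
S(x,t), so that tD(t) = V(t)/χ. The claim is that V is non-decreasing.

Derivative. By conservation of particles V' is a sum of currents. The current through the bond (y,
y+1) is (P - bρ) c_y - (Q + bρ) c_{y+1} - b c_y c_{y+1} + bχ. The linear part produces the velocity
v, which the recentring cancels, and the term ∑ S = χ. The quadratic part leaves -b ∑ (2y + 1 - 2vt)
E[c_y c_{y+1}(t) c_0(0)]. Time reversal and translation turn this correlation into that of c_0 c_1
at time 0 with c_{-y} at time t, for the process with P and Q exchanged. Its sum over y vanishes by
conservation, hence V' = χ + 2b ∑ x E'[c_0 c_1(0) c_x(t)], with E' for the exchanged process.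

Sign. The last sum is χ² times the mean of the mixed difference, in the sites 0 and 1, of the
exchanged semigroup applied to H = ∑ x c_x. Consider the cone of functions G that increase when a
particle moves to the right and for which b times every mixed difference is non-negative. Resampling
a bond preserves this cone (`IsDriftModular.resample`): unless the bond carries both sites, it only
relocates the two sites and keeps their order; if it carries both, it adds b (G(01) - G(10)) to the
mixed difference, which has the sign of b. Since H lies in the cone, V' ≥ χ ≥ 0.

Infinite volume. The calculation is done in boxes [-m, m] with bounded generators. The influence of
a site decays exponentially, uniformly in the box (`HasInfluence.semigroup`), and Duhamel's
principle (`abs_dual_sub_exp_le`) then identifies the two-point function of any solution of the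
martingale problem as a limit of box quantities (`tendsto_twoPoint`). A box has a boundary, which
spoils time reversal; duality is exact on a ring, and ring and box agree in the limit
(`tendsto_boxBondCorr_sub`). The boundary and duality errors are summably dominated and vanish in
the limit (`tendsto_integral_boxError`). -/

namespace ExclusionProcess

open NormedSpace (exp)

/-! ### Semigroups of bounded operators and Duhamel's principle -/

section Semigroup

variable {E : Type*} [NormedAddCommGroup E] [NormedSpace ℝ E]

/-- The semigroup generated by a bounded operator. -/
noncomputable def opSemigroup (L : E →L[ℝ] E) (t : ℝ) : E →L[ℝ] E := exp (t • L)

lemma opSemigroup_zero (L : E →L[ℝ] E) : opSemigroup L 0 = 1 := by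
  simp [opSemigroup]

variable [CompleteSpace E]

lemma hasSum_exp_smul_apply (K : E →L[ℝ] E) (t : ℝ) (f : E) :
    HasSum (fun k : ℕ => (t ^ k / k.factorial) • (K ^ k) f) (opSemigroup K t f) := by
  have h := NormedSpace.exp_series_hasSum_exp' (𝕂 := ℝ) (t • K)
  have h2 := ((ContinuousLinearMap.apply ℝ E f).hasSum h)
  rw [ContinuousLinearMap.apply_apply] at h2
  convert h2 using 1
  · ext k
    simp [smul_pow, smul_smul, div_eq_inv_mul]
  · rfl

lemma hasSum_dual_exp_smul (φ : E →L[ℝ] ℝ) (K : E →L[ℝ] E) (t : ℝ) (f : E) :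
    HasSum (fun k : ℕ => t ^ k / k.factorial * φ ((K ^ k) f)) (φ (opSemigroup K t f)) := by
  simpa using φ.hasSum (hasSum_exp_smul_apply K t f)

lemma exp_smul_apply_of_apply_eq_zero {K : E →L[ℝ] E} {f : E} (h : K f = 0) (t : ℝ) :
    opSemigroup K t f = f := by
  refine (hasSum_exp_smul_apply K t f).unique ?_
  convert hasSum_single (α := E) 0 ?_ using 1
  · simp
  · intro k hk
    obtain ⟨m, rfl⟩ := Nat.exists_eq_succ_of_ne_zero hk
    simp [pow_succ, h]

lemma dual_exp_smul_congr {E' : Type*} [NormedAddCommGroup E'] [NormedSpace ℝ E']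
    [CompleteSpace E'] {φ : E →L[ℝ] ℝ} {ψ : E' →L[ℝ] ℝ} {K : E →L[ℝ] E} {K' : E' →L[ℝ] E'} {f : E}
    {f' : E'} (h : ∀ k : ℕ, φ ((K ^ k) f) = ψ ((K' ^ k) f')) (t : ℝ) :
    φ (opSemigroup K t f) = ψ (opSemigroup K' t f') := by
  refine (hasSum_dual_exp_smul φ K t f).unique ?_
  simp_rw [h]
  exact hasSum_dual_exp_smul ψ K' t f'

/-- The generators below are a positive operator `K` minus its number of bonds. Splitting off the
scalar leaves a power series in `K` with non-negative coefficients for t ≥ 0, so bounds and signs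
need only be checked on the powers of `K`. -/
lemma exp_smul_sub_smul_one (K : E →L[ℝ] E) (n t : ℝ) :
    opSemigroup (K - n • (1 : E →L[ℝ] E)) t = Real.exp (-(t * n)) • opSemigroup K t := by
  unfold opSemigroup
  have h : t • (K - n • (1 : E →L[ℝ] E)) = (-(t * n)) • (1 : E →L[ℝ] E) + t • K := by
    rw [smul_sub, smul_smul, neg_smul]; abel
  have hc : Commute ((-(t * n)) • (1 : E →L[ℝ] E)) (t • K) :=
    ((Commute.one_left K).smul_right t).smul_left _
  let +nondep : NormedAlgebra ℚ (E →L[ℝ] E) := .restrictScalars ℚ ℝ _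
  rw [h, NormedSpace.exp_add_of_commute hc]
  have : exp ((-(t * n)) • (1 : E →L[ℝ] E)) = Real.exp (-(t * n)) • (1 : E →L[ℝ] E) := by
    have := NormedSpace.algebraMap_exp_comm (𝕂 := ℝ) (𝔸 := E →L[ℝ] E) (-(t * n))
    rw [← Real.exp_eq_exp_ℝ] at this
    rw [Algebra.algebraMap_eq_smul_one, Algebra.algebraMap_eq_smul_one] at this
    exact this.symm
  rw [this, smul_mul_assoc, one_mul]

/-- If the powers of `K` increase a functional at most geometrically, then the semigroup of
`K - n` increases it at most exponentially. -/
lemma abs_dual_exp_le {φ : E →L[ℝ] ℝ} {K : E →L[ℝ] E} {f : E} {a m : ℝ}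
    (h : ∀ k : ℕ, |φ ((K ^ k) f)| ≤ m ^ k * a) (n : ℝ) {t : ℝ} (ht : 0 ≤ t) :
    |φ (opSemigroup (K - n • (1 : E →L[ℝ] E)) t f)| ≤ Real.exp (t * (m - n)) * a := by
  have h1 : |φ (opSemigroup K t f)| ≤ Real.exp (t * m) * a := by
    have hs := hasSum_dual_exp_smul φ K t f
    have he : HasSum (fun k : ℕ => t ^ k / k.factorial * (m ^ k * a)) (Real.exp (t * m) * a) := by
      have := (NormedSpace.expSeries_div_hasSum_exp (𝔸 := ℝ) (t * m)).mul_right a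
      rw [← Real.exp_eq_exp_ℝ] at this
      have e : (fun k : ℕ => t ^ k / k.factorial * (m ^ k * a)) =
          fun k : ℕ => (t * m) ^ k / k.factorial * a := by
        ext k; rw [mul_pow]; ring
      rw [e]; exact this
    rw [← Real.norm_eq_abs, ← hs.tsum_eq]
    refine tsum_of_norm_bounded he fun k => ?_
    rw [norm_mul, Real.norm_of_nonneg (by positivity)]
    exact mul_le_mul_of_nonneg_left (h k) (by positivity)
  rw [exp_smul_sub_smul_one, smul_apply, map_smul, smul_eq_mul, abs_mul,
    abs_of_pos (Real.exp_pos _), show t * (m - n) = -(t * n) + t * m by ring, Real.exp_add,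
    mul_assoc]
  exact mul_le_mul_of_nonneg_left h1 (Real.exp_pos _).le

lemma dual_exp_nonneg {φ : E →L[ℝ] ℝ} {K : E →L[ℝ] E} {f : E}
    (h : ∀ k : ℕ, 0 ≤ φ ((K ^ k) f)) (n : ℝ) {t : ℝ} (ht : 0 ≤ t) :
    0 ≤ φ (opSemigroup (K - n • (1 : E →L[ℝ] E)) t f) := by
  rw [exp_smul_sub_smul_one, smul_apply, map_smul, smul_eq_mul]
  refine mul_nonneg (Real.exp_pos _).le ?_
  exact (hasSum_dual_exp_smul φ K t f).nonneg fun k => mul_nonneg (by positivity) (h k)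

lemma hasDerivAt_exp_smul_apply (K : E →L[ℝ] E) (f : E) (t : ℝ) :
    HasDerivAt (fun s : ℝ => opSemigroup K s f) (opSemigroup K t (K f)) t := by
  have := (hasDerivAt_exp_smul_const (𝕂 := ℝ) K t)
  have h2 := (ContinuousLinearMap.apply ℝ E f).hasFDerivAt.comp_hasDerivAt t this
  simpa [Function.comp_def, opSemigroup] using h2

lemma hasDerivAt_exp_smul_apply' (K : E →L[ℝ] E) (f : E) (t : ℝ) :
    HasDerivAt (fun s : ℝ => opSemigroup K s f) (K (opSemigroup K t f)) t := by
  have := (hasDerivAt_exp_smul_const' (𝕂 := ℝ) K t)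
  have h2 := (ContinuousLinearMap.apply ℝ E f).hasFDerivAt.comp_hasDerivAt t this
  simpa [Function.comp_def, opSemigroup] using h2

/-- A product rule for a family of functionals that is differentiable only weakly. -/
lemma hasDerivWithinAt_dual_apply {E : Type*} [NormedAddCommGroup E] [NormedSpace ℝ E]
    {U : ℝ → E →L[ℝ] ℝ} {C : ℝ} (hC : ∀ s, ‖U s‖ ≤ C) {F : ℝ → E}
    {F' : E} {S : Set ℝ} {s d : ℝ} (hF : HasDerivAt F F' s)
    (hU : HasDerivWithinAt (fun r => U r (F s)) d S s)
    (hc : ContinuousWithinAt (fun r => U r F') S s) :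
    HasDerivWithinAt (fun r => U r (F r)) (d + U s F') S s := by
  -- `U r (F r)` is split into the Taylor remainder of `F`, controlled by the uniform bound `C`, the
  -- term `U r (F s)`, and the term `(r - s) * U r F'`. Thus `U` is only ever differentiated on a
  -- fixed vector.
  have h1 : HasDerivWithinAt (fun r => U r (F r - F s - (r - s) • F')) 0 S s := by
    rw [hasDerivWithinAt_iff_isLittleO]
    have h0 := (hasDerivAt_iff_isLittleO.mp hF).mono (nhdsWithin_le_nhds (s := S))
    refine Asymptotics.IsBigO.trans_isLittleO ?_ h0
    refine Asymptotics.IsBigO.of_bound C (Eventually.of_forall fun r => ?_)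
    simpa using (U r).le_of_opNorm_le (hC r) (F r - F s - (r - s) • F')
  have h2 : HasDerivWithinAt (fun r => (r - s) * U r F') (U s F') S s := by
    rw [hasDerivWithinAt_iff_tendsto_slope]
    have hc' : Tendsto (fun r => U r F') (𝓝[S \ {s}] s) (𝓝 (U s F')) :=
      hc.mono_left (nhdsWithin_mono _ Set.sdiff_subset)
    refine hc'.congr' ?_
    filter_upwards [self_mem_nhdsWithin] with r hr
    have : r - s ≠ 0 := sub_ne_zero.mpr hr.2
    simp only [slope_def_field]
    field_simp
    ring
  have h3 := (h1.add hU).add h2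
  rw [zero_add] at h3
  refine h3.congr_of_eventuallyEq (Eventually.of_forall fun r => ?_) ?_ <;> (simp; try ring)

/-- Duhamel's principle: a family of functionals whose evolution is approximately dual to `L` is
approximated by the semigroup of `L`. -/
lemma abs_dual_sub_exp_le {U : ℝ → E →L[ℝ] ℝ} {C : ℝ} (hC : ∀ s, ‖U s‖ ≤ C) (L : E →L[ℝ] E) (f : E)
    {t δ : ℝ} (ht : 0 ≤ t)
    (hc : ∀ s, 0 ≤ s → s ≤ t →
      ContinuousOn (fun r => U r (opSemigroup L (t - s) f)) (Set.Ici 0) ∧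
      ContinuousOn (fun r => U r (L (opSemigroup L (t - s) f))) (Set.Ici 0))
    (hd : ∀ s, 0 ≤ s → s < t → ∃ d, HasDerivWithinAt (fun r => U r (opSemigroup L (t - s) f)) d
      (Set.Ici s) s ∧ |d - U s (L (opSemigroup L (t - s) f))| ≤ δ) :
    |U t f - U 0 (opSemigroup L t f)| ≤ t * δ := by
  set F : ℝ → E := fun s => opSemigroup L (t - s) f with hFdef
  have hF : ∀ s, HasDerivAt F (-(L (F s))) s := by
    intro s
    have h1 := hasDerivAt_exp_smul_apply' L f (t - s)
    have h2 : HasDerivAt (fun r : ℝ => t - r) (-1) s := by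
      simpa using (hasDerivAt_id s).const_sub t
    have := HasDerivAt.scomp s h1 h2
    simpa [hFdef, Function.comp_def] using this
  have hFc : Continuous F := continuous_iff_continuousAt.2 fun s => (hF s).continuousAt
  have hcont : ContinuousOn (fun r => U r (F r)) (Set.Icc 0 t) := by
    intro s hs
    have hA : ContinuousWithinAt (fun r => U r (F s)) (Set.Icc 0 t) s :=
      ((hc s hs.1 hs.2).1 s hs.1).mono Set.Icc_subset_Ici_self
    have hB : Tendsto (fun r => U r (F r - F s)) (𝓝[Set.Icc 0 t] s) (𝓝 0) := by
      refine squeeze_zero_norm (a := fun r => C * ‖F r - F s‖)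
        (fun r => (U r).le_of_opNorm_le (hC r) _) ?_
      have : Tendsto (fun r => C * ‖F r - F s‖) (𝓝 s) (𝓝 (C * ‖F s - F s‖)) :=
        (((hFc.tendsto s).sub_const _).norm).const_mul C
      simp only [sub_self, norm_zero, mul_zero] at this
      exact this.mono_left nhdsWithin_le_nhds
    have := hB.add hA
    simpa [ContinuousWithinAt] using this
  -- The path s ↦ `U s (F s)` runs from `U 0 (opSemigroup L t f)` to `U t f`, and its right
  -- derivative is the defect bounded by `δ`. The derivative `d` is available on [0, t) only; the
  -- value 0 elsewhere plays no role.
  have key := norm_image_sub_le_of_norm_deriv_right_le_segment (f := fun r => U r (F r))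
    (f' := fun s => if h : 0 ≤ s ∧ s < t then (hd s h.1 h.2).choose - U s (L (F s)) else 0)
    (C := δ) (a := 0) (b := t) hcont ?_ ?_ t ⟨ht, le_rfl⟩
  · simpa [hFdef, mul_comm, opSemigroup_zero] using key
  · intro s hs
    have hs' : 0 ≤ s ∧ s < t := ⟨hs.1, hs.2⟩
    simp only [hs', and_self, dite_true]
    have h1 := (hd s hs.1 hs.2).choose_spec.1
    have := hasDerivWithinAt_dual_apply hC (hF s) h1 ?_
    · simpa [sub_eq_add_neg] using this
    · have h2 := ((hc s hs.1 hs.2.le).2 s hs.1).mono (Set.Ici_subset_Ici.2 hs.1)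
      simpa [hFdef] using h2.fun_neg
  · intro s hs
    have hs' : 0 ≤ s ∧ s < t := ⟨hs.1, hs.2⟩
    simp only [hs', and_self, dite_true]
    exact (hd s hs.1 hs.2).choose_spec.2

end Semigroup

end ExclusionProcess

namespace ExclusionProcess

open Function (update)

/-! ### Moves of particles -/

/-- Move a particle from `u` to `v`, if `u` is occupied and `v` is empty. -/
def move (u v : ℤ) (σ : Config) : Config := update (update σ v (σ u || σ v)) u (σ u && σ v)

lemma move_apply (u v : ℤ) (σ : Config) (x : ℤ) :
    move u v σ x = if x = u then (σ u && σ v) else if x = v then (σ u || σ v) else σ x := by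
  simp only [move, Function.update_apply]

lemma move_update_of_ne {u v y : ℤ} (hu : y ≠ u) (hv : y ≠ v) (σ : Config) (c : Bool) :
    move u v (update σ y c) = update (move u v σ) y c := by
  ext x
  simp only [move_apply, Function.update_apply, hu.symm, hv.symm, if_false]
  split_ifs <;> simp_all

/-- A single discrepancy stays a single discrepancy, and it moves along the bond only. -/
lemma exists_move_update {u v : ℤ} (huv : u ≠ v) (y : ℤ) (σ : Config) :
    ∃ y' σ', (y' = y ∨ ((y = u ∨ y = v) ∧ (y' = u ∨ y' = v))) ∧
      ∀ c, move u v (update σ y c) = update σ' y' c := by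
  by_cases hu : y = u
  · subst hu
    cases h : σ v
    · refine ⟨v, update σ y false, Or.inr ⟨.inl rfl, .inr rfl⟩, fun c => ?_⟩
      ext x
      simp only [move_apply, Function.update_apply, huv.symm, if_false, if_true, h]
      split_ifs <;> simp_all
    · refine ⟨y, σ, Or.inl rfl, fun c => ?_⟩
      ext x
      simp only [move_apply, Function.update_apply, huv.symm, if_false, if_true, h]
      split_ifs <;> simp_all
  by_cases hv : y = v
  · subst hv
    cases h : σ u
    · refine ⟨y, σ, Or.inl rfl, fun c => ?_⟩
      ext x
      simp only [move_apply, Function.update_apply, huv, if_false, if_true, h]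
      split_ifs <;> simp_all
    · refine ⟨u, update σ y true, Or.inr ⟨.inr rfl, .inl rfl⟩, fun c => ?_⟩
      ext x
      simp only [move_apply, Function.update_apply, huv, if_false, if_true, h]
      split_ifs <;> simp_all
  · exact ⟨y, move u v σ, Or.inl rfl, fun c => move_update_of_ne hu hv σ c⟩

/-- Two discrepancies that do not occupy the bond `{w, w + 1}` keep their order. -/
lemma exists_move_update_update {u v w x y : ℤ}
    (hb : (u = w ∧ v = w + 1) ∨ (u = w + 1 ∧ v = w)) (hxy : x < y) (hne : ¬(x = w ∧ y = w + 1))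
    (σ : Config) : ∃ x' y' σ', x' < y' ∧ (x' = x ∨ x' = w ∨ x' = w + 1) ∧
      (y' = y ∨ y' = w ∨ y' = w + 1) ∧ ∀ a c, move u v (update (update σ x a) y c) = update (update σ' x' a) y' c := by
  have huv : u ≠ v := by omega
  by_cases hy : y = u ∨ y = v
  · have hxu : x ≠ u := by omega
    have hxv : x ≠ v := by omega
    obtain ⟨y', σ', h1, h2⟩ := exists_move_update huv y σ
    refine ⟨x, y', σ', by omega, .inl rfl, by omega, fun a c => ?_⟩
    rw [Function.update_comm hxy.ne, move_update_of_ne hxu hxv, h2, Function.update_comm]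
    omega
  · obtain ⟨x', σ', h1, h2⟩ := exists_move_update huv x σ
    refine ⟨x', y, σ', by omega, by omega, .inl rfl, fun a c => ?_⟩
    rw [move_update_of_ne (by tauto) (by tauto), h2]

lemma continuous_move (u v : ℤ) : Continuous (move u v) := by
  refine continuous_pi fun x => ?_
  simp only [move_apply]
  have h : Continuous fun σ : Config => (σ u, σ v) := by fun_prop
  split_ifs
  · exact (continuous_of_discreteTopology (f := fun q : Bool × Bool => q.1 && q.2)).comp h
  · exact (continuous_of_discreteTopology (f := fun q : Bool × Bool => q.1 || q.2)).comp h
  · fun_prop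

/-! ### The generator of finitely many bonds -/

/-- Composition with a continuous map, as a bounded operator. -/
noncomputable def compOp (m : C(Config, Config)) : C(Config, ℝ) →L[ℝ] C(Config, ℝ) :=
  LinearMap.mkContinuous
    { toFun := fun f => f.comp m
      map_add' := fun _ _ => rfl
      map_smul' := fun _ _ => rfl } 1 fun f => by
    rw [one_mul]
    exact (ContinuousMap.norm_le _ (norm_nonneg _)).2 fun σ => f.norm_coe_le_norm (m σ)

@[simp] lemma compOp_apply (m : C(Config, Config)) (f : C(Config, ℝ)) (σ : Config) :
    compOp m f σ = f (m σ) := rfl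

/-- Resample the bond `(u, v)`: a single particle on it is put to `v` with probability `P` and to
`u` with probability `Q`. -/
noncomputable def resample (P Q : ℝ) (e : ℤ × ℤ) : C(Config, ℝ) →L[ℝ] C(Config, ℝ) :=
  P • compOp ⟨_, continuous_move e.1 e.2⟩ + Q • compOp ⟨_, continuous_move e.2 e.1⟩

lemma resample_apply (P Q : ℝ) (e : ℤ × ℤ) (f : C(Config, ℝ)) (σ : Config) :
    resample P Q e f σ = P * f (move e.1 e.2 σ) + Q * f (move e.2 e.1 σ) := rfl

/-- The sum of the resampling operators of the bonds in `B`. -/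
noncomputable def resampleSum (P Q : ℝ) (B : Finset (ℤ × ℤ)) : C(Config, ℝ) →L[ℝ] C(Config, ℝ) :=
  ∑ e ∈ B, resample P Q e

lemma resampleSum_apply (P Q : ℝ) (B : Finset (ℤ × ℤ)) (f : C(Config, ℝ)) (σ : Config) :
    resampleSum P Q B f σ = ∑ e ∈ B, resample P Q e f σ := by
  simp [resampleSum, ContinuousMap.sum_apply]

/-- The generator of the exclusion process on the bonds in `B`. -/
noncomputable def bondGen (P Q : ℝ) (B : Finset (ℤ × ℤ)) : C(Config, ℝ) →L[ℝ] C(Config, ℝ) :=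
  resampleSum P Q B - (B.card : ℝ) • 1

lemma bondGen_apply (P Q : ℝ) (B : Finset (ℤ × ℤ)) (f : C(Config, ℝ)) (σ : Config) :
    bondGen P Q B f σ = ∑ e ∈ B, (resample P Q e f σ - f σ) := by
  simp [bondGen, resampleSum_apply]

/-- The semigroup of the exclusion process on the bonds in `B`. -/
noncomputable def semigroup (P Q : ℝ) (B : Finset (ℤ × ℤ)) (t : ℝ) :
    C(Config, ℝ) →L[ℝ] C(Config, ℝ) := opSemigroup (bondGen P Q B) t

lemma semigroup_zero (P Q : ℝ) (B : Finset (ℤ × ℤ)) (f : C(Config, ℝ)) :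
    semigroup P Q B 0 f = f := by
  simp [semigroup, opSemigroup_zero]

lemma norm_resample_le {P Q : ℝ} (hP : 0 ≤ P) (hQ : 0 ≤ Q) (hPQ : P + Q = 1) (e : ℤ × ℤ)
    (f : C(Config, ℝ)) : ‖resample P Q e f‖ ≤ ‖f‖ := by
  refine (ContinuousMap.norm_le _ (norm_nonneg _)).2 fun σ => ?_
  rw [resample_apply]
  calc ‖P * f (move e.1 e.2 σ) + Q * f (move e.2 e.1 σ)‖
      ≤ ‖P * f (move e.1 e.2 σ)‖ + ‖Q * f (move e.2 e.1 σ)‖ := norm_add_le _ _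
    _ = P * ‖f (move e.1 e.2 σ)‖ + Q * ‖f (move e.2 e.1 σ)‖ := by
        rw [norm_mul, norm_mul, Real.norm_of_nonneg hP, Real.norm_of_nonneg hQ]
    _ ≤ P * ‖f‖ + Q * ‖f‖ := by gcongr <;> exact f.norm_coe_le_norm _
    _ = ‖f‖ := by rw [← add_mul, hPQ, one_mul]

/-- Each resampling is an average, so the k-th power of their sum grows at most like the k-th power
of the number of bonds, which the scalar part of the generator compensates exactly. -/
lemma norm_semigroup_le {P Q : ℝ} (hP : 0 ≤ P) (hQ : 0 ≤ Q) (hPQ : P + Q = 1)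
    (B : Finset (ℤ × ℤ)) {t : ℝ} (ht : 0 ≤ t) (f : C(Config, ℝ)) :
    ‖semigroup P Q B t f‖ ≤ ‖f‖ := by
  refine (ContinuousMap.norm_le _ (norm_nonneg _)).2 fun σ => ?_
  have h : ∀ k : ℕ, ‖(resampleSum P Q B ^ k) f‖ ≤ (B.card : ℝ) ^ k * ‖f‖ := by
    intro k
    induction k with
    | zero => simp
    | succ k ih =>
      rw [pow_succ', mul_apply_eq_comp, pow_succ', mul_assoc]
      refine le_trans ?_ (mul_le_mul_of_nonneg_left ih (Nat.cast_nonneg _))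
      rw [resampleSum, _root_.sum_apply]
      refine (norm_sum_le _ _).trans ?_
      refine (Finset.sum_le_sum fun e _ => norm_resample_le hP hQ hPQ e _).trans ?_
      simp
  have := abs_dual_exp_le (φ := ContinuousMap.evalCLM ℝ σ) (K := resampleSum P Q B) (f := f)
    (a := ‖f‖) (m := B.card) (fun k => (ContinuousMap.norm_coe_le_norm _ σ).trans (h k)) B.card ht
  simpa [semigroup, bondGen] using this

lemma semigroup_of_invariant {P Q : ℝ} (hPQ : P + Q = 1) {B : Finset (ℤ × ℤ)} {f : C(Config, ℝ)}
    (hf : ∀ e ∈ B, ∀ σ, f (move e.1 e.2 σ) = f σ ∧ f (move e.2 e.1 σ) = f σ) (t : ℝ) :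
    semigroup P Q B t f = f := by
  refine exp_smul_apply_of_apply_eq_zero ?_ t
  ext σ
  rw [bondGen_apply]
  refine Finset.sum_eq_zero fun e he => ?_
  rw [resample_apply, (hf e he σ).1, (hf e he σ).2, ← add_mul, hPQ, one_mul, sub_self]

lemma dependsOn_semigroup {P Q : ℝ} {B : Finset (ℤ × ℤ)} {A : Set ℤ}
    (hB : ∀ e ∈ B, e.1 ∈ A ∧ e.2 ∈ A) {f : C(Config, ℝ)} (hf : DependsOn f A) {t : ℝ}
    (ht : 0 ≤ t) : DependsOn (semigroup P Q B t f) A := by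
  intro σ τ hστ
  have h : ∀ k : ℕ, DependsOn ((resampleSum P Q B ^ k) f) A := by
    intro k
    induction k with
    | zero => simpa using hf
    | succ k ih =>
      rw [pow_succ', mul_apply_eq_comp]
      intro σ τ hστ
      rw [resampleSum_apply, resampleSum_apply]
      refine Finset.sum_congr rfl fun e he => ?_
      have h1 := hστ _ (hB e he).1
      have h2 := hστ _ (hB e he).2
      rw [resample_apply, resample_apply]
      congr 2 <;>
      · refine ih fun x hx => ?_
        simp only [move_apply, h1, h2, hστ x hx]
  -- The difference of the two evaluations vanishes on every power, so the bound applies with `a =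
  -- 0`.
  have := abs_dual_exp_le
    (φ := ContinuousMap.evalCLM ℝ σ - ContinuousMap.evalCLM ℝ τ) (K := resampleSum P Q B) (f := f)
    (a := 0) (m := B.card) (fun k => ?_) B.card ht
  · rw [mul_zero, abs_nonpos_iff] at this
    exact sub_eq_zero.1 this
  · rw [mul_zero, abs_nonpos_iff]
    exact sub_eq_zero.2 (h k hστ)

/-! ### Propagation of influence -/

/-- The nearest-neighbour bonds with left endpoints in `s`. -/
def lineBonds (s : Finset ℤ) : Finset (ℤ × ℤ) :=
  s.map ⟨fun x => (x, x + 1), fun _ _ h => (Prod.ext_iff.1 h).1⟩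

lemma mem_lineBonds {s : Finset ℤ} {e : ℤ × ℤ} : e ∈ lineBonds s ↔ e.1 ∈ s ∧ e.2 = e.1 + 1 := by
  simp only [lineBonds, Finset.mem_map, Prod.ext_iff]
  constructor
  · rintro ⟨a, ha, h1, h2⟩
    subst h1
    exact ⟨ha, h2.symm⟩
  · rintro ⟨h1, h2⟩
    exact ⟨e.1, h1, rfl, h2.symm⟩

lemma sum_lineBonds {M : Type*} [AddCommMonoid M] (s : Finset ℤ) (g : ℤ × ℤ → M) :
    ∑ e ∈ lineBonds s, g e = ∑ x ∈ s, g (x, x + 1) := by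
  simp [lineBonds]
  rfl

/-- An exponentially decaying weight on the sites. -/
noncomputable def decay (z : ℤ) : ℝ := (1 / 2) ^ z.natAbs

lemma decay_pos (z : ℤ) : 0 < decay z := by unfold decay; positivity

lemma decay_neg (z : ℤ) : decay (-z) = decay z := by simp [decay]

lemma decay_anti {y z : ℤ} (h : |y| ≤ |z|) : decay z ≤ decay y :=
  pow_le_pow_of_le_one (by norm_num) (by norm_num) (by zify; exact h)

lemma decay_le_two_mul {y z : ℤ} (h : |y - z| ≤ 1) : decay y ≤ 2 * decay z := by
  have h1 : z.natAbs ≤ y.natAbs + 1 := by rw [abs_le] at h; omega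
  have h2 : (1 / 2 : ℝ) ^ (y.natAbs + 1) ≤ (1 / 2) ^ z.natAbs :=
    pow_le_pow_of_le_one (by norm_num) (by norm_num) h1
  rw [pow_succ] at h2
  unfold decay
  linarith

/-- Changing `f` at the site `z` changes its value by at most `A` times the weight of `z - x₀`. -/
def HasInfluence (f : C(Config, ℝ)) (A : ℝ) (x₀ : ℤ) : Prop :=
  ∀ z σ c c', |f (update σ z c) - f (update σ z c')| ≤ A * decay (z - x₀)

/-- A bond away from `z` leaves the discrepancy in place. One of the two bonds at `z` can carry it
to a neighbour, where the weight is at most twice as large; the indicators account for this extra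
unit. -/
lemma HasInfluence.resample {P Q : ℝ} (hP : 0 ≤ P) (hQ : 0 ≤ Q) (hPQ : P + Q = 1)
    {f : C(Config, ℝ)} {A : ℝ} {x₀ : ℤ} (hA : 0 ≤ A) (hf : HasInfluence f A x₀) (x z : ℤ)
    (σ : Config) (c c' : Bool) :
    |resample P Q (x, x + 1) f (update σ z c) - resample P Q (x, x + 1) f (update σ z c')| ≤
      (1 + (if x = z then 1 else 0) + (if x = z - 1 then 1 else 0)) * (A * decay (z - x₀)) := by
  have key : ∀ u v : ℤ, (u = x ∧ v = x + 1) ∨ (u = x + 1 ∧ v = x) →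
      |f (move u v (update σ z c)) - f (move u v (update σ z c'))| ≤
        (1 + (if x = z then 1 else 0) + (if x = z - 1 then 1 else 0)) * (A * decay (z - x₀)) := by
    intro u v huv
    have hne : u ≠ v := by omega
    obtain ⟨z', σ', h1, h2⟩ := exists_move_update hne z σ
    rw [h2, h2]
    refine (hf _ _ _ _).trans ?_
    have hd := decay_pos (z - x₀)
    rcases h1 with rfl | ⟨h1, h3⟩
    · refine le_mul_of_one_le_left (by positivity) ?_
      split_ifs <;> norm_num
    · have h4 : decay (z' - x₀) ≤ 2 * decay (z - x₀) := decay_le_two_mul (by grind)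
      have h5 : (2 : ℝ) ≤ 1 + (if x = z then 1 else 0) + (if x = z - 1 then 1 else 0) := by
        have : x = z ∨ x = z - 1 := by omega
        rcases this with h | h <;> split_ifs <;> norm_num
      calc A * decay (z' - x₀) ≤ A * (2 * decay (z - x₀)) := by gcongr
        _ = 2 * (A * decay (z - x₀)) := by ring
        _ ≤ _ := by gcongr
  rw [resample_apply, resample_apply]
  set R := (1 + (if x = z then 1 else 0) + (if x = z - 1 then 1 else 0)) * (A * decay (z - x₀))
  have k1 := abs_le.1 (key x (x + 1) (.inl ⟨rfl, rfl⟩))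
  have k2 := abs_le.1 (key (x + 1) x (.inr ⟨rfl, rfl⟩))
  rw [abs_le]
  have e : R = P * R + Q * R := by rw [← add_mul, hPQ, one_mul]
  constructor
  · nlinarith [mul_le_mul_of_nonneg_left k1.1 hP, mul_le_mul_of_nonneg_left k2.1 hQ]
  · nlinarith [mul_le_mul_of_nonneg_left k1.2 hP, mul_le_mul_of_nonneg_left k2.2 hQ]

/-- Summing over the bonds multiplies the influence by at most their number plus 2. The scalar part
removes the number of bonds, so the growth rate 2 does not depend on the system. -/
lemma HasInfluence.semigroup {P Q : ℝ} (hP : 0 ≤ P) (hQ : 0 ≤ Q) (hPQ : P + Q = 1)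
    {f : C(Config, ℝ)} {A : ℝ} {x₀ : ℤ} (hA : 0 ≤ A) (hf : HasInfluence f A x₀) (s : Finset ℤ)
    {t : ℝ} (ht : 0 ≤ t) :
    HasInfluence (semigroup P Q (lineBonds s) t f) (Real.exp (2 * t) * A) x₀ := by
  have h : ∀ k : ℕ,
      HasInfluence ((resampleSum P Q (lineBonds s) ^ k) f) ((s.card + 2 : ℝ) ^ k * A) x₀ := by
    intro k
    induction k with
    | zero => simpa using hf
    | succ k ih =>
      intro z σ c c'
      rw [pow_succ', mul_apply_eq_comp, resampleSum_apply, resampleSum_apply,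
        ← Finset.sum_sub_distrib, sum_lineBonds]
      refine (Finset.abs_sum_le_sum_abs _ _).trans ?_
      refine (Finset.sum_le_sum fun x _ =>
        HasInfluence.resample hP hQ hPQ (by positivity) ih x z σ c c').trans ?_
      rw [← Finset.sum_mul]
      have h1 : ∑ x ∈ s, ((1 : ℝ) + (if x = z then 1 else 0) + (if x = z - 1 then 1 else 0)) ≤
          s.card + 2 := by
        rw [Finset.sum_add_distrib, Finset.sum_add_distrib, Finset.sum_ite_eq',
          Finset.sum_ite_eq']
        simp only [Finset.sum_const, nsmul_eq_mul, mul_one]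
        split_ifs <;> linarith
      have hd := decay_pos (z - x₀)
      calc _ ≤ (s.card + 2 : ℝ) * ((s.card + 2 : ℝ) ^ k * A * decay (z - x₀)) := by gcongr
        _ = _ := by rw [pow_succ']; ring
  intro z σ c c'
  have := abs_dual_exp_le (φ := ContinuousMap.evalCLM ℝ (update σ z c) -
      ContinuousMap.evalCLM ℝ (update σ z c')) (K := resampleSum P Q (lineBonds s)) (f := f)
    (a := A * decay (z - x₀)) (m := (s.card + 2 : ℝ))
    (fun k => by rw [← mul_assoc]; exact h k z σ c c') (lineBonds s).card ht
  have e : ((s.card : ℝ) + 2 - (lineBonds s).card) = 2 := by simp [lineBonds]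
  rw [e, ← mul_assoc, mul_comm t 2] at this
  exact this

lemma abs_resample_sub_le_of_hasInfluence {P Q : ℝ} (hP : 0 ≤ P) (hQ : 0 ≤ Q) (hPQ : P + Q = 1)
    {f : C(Config, ℝ)} {A : ℝ} {x₀ : ℤ} (hf : HasInfluence f A x₀) (e : ℤ × ℤ) (σ : Config) :
    |resample P Q e f σ - f σ| ≤ A * (decay (e.1 - x₀) + decay (e.2 - x₀)) := by
  have key : ∀ u v : ℤ, |f (move u v σ) - f σ| ≤ A * (decay (v - x₀) + decay (u - x₀)) := by
    intro u v
    have h1 := hf u (update σ v (σ u || σ v)) (σ u && σ v) (update σ v (σ u || σ v) u)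
    have h2 := hf v σ (σ u || σ v) (σ v)
    rw [Function.update_eq_self] at h1 h2
    have := abs_add_le (f (move u v σ) - f (update σ v (σ u || σ v)))
      (f (update σ v (σ u || σ v)) - f σ)
    rw [sub_add_sub_cancel] at this
    rw [mul_add]
    unfold move at this ⊢
    linarith
  rw [resample_apply]
  have k1 := abs_le.1 (key e.1 e.2)
  have k2 := abs_le.1 (key e.2 e.1)
  have e1 : f σ = P * f σ + Q * f σ := by rw [← add_mul, hPQ, one_mul]
  have e2 : A * (decay (e.1 - x₀) + decay (e.2 - x₀)) =
      P * (A * (decay (e.1 - x₀) + decay (e.2 - x₀))) +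
      Q * (A * (decay (e.1 - x₀) + decay (e.2 - x₀))) := by rw [← add_mul, hPQ, one_mul]
  rw [abs_le]
  constructor
  · nlinarith [mul_le_mul_of_nonneg_left k1.1 hP, mul_le_mul_of_nonneg_left k2.1 hQ]
  · nlinarith [mul_le_mul_of_nonneg_left k1.2 hP, mul_le_mul_of_nonneg_left k2.2 hQ]

/-! ### The cone of supermodular functions -/

/-- Functions that increase when a particle moves to the right inside of `A`, and whose multiple
by `b` is supermodular there. -/
structure IsDriftModular (A : Set ℤ) (b : ℝ) (H : C(Config, ℝ)) : Prop where
  mono : ∀ x y σ, x ∈ A → y ∈ A → x < y →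
    H (update (update σ x true) y false) ≤ H (update (update σ x false) y true)
  modular : ∀ x y σ, x ∈ A → y ∈ A → x < y →
    0 ≤ b * (H (update (update σ x true) y true) - H (update (update σ x true) y false) -
      H (update (update σ x false) y true) + H (update (update σ x false) y false))

lemma move_update_update_self {u v : ℤ} (huv : u ≠ v) (σ : Config) (a c : Bool) :
    move u v (update (update σ u a) v c) = update (update σ u (a && c)) v (a || c) := by
  ext x
  simp only [move_apply, Function.update_apply, huv, huv.symm, if_false, if_true]
  split_ifs <;> simp_all

/-- Monotonicity is part of the cone because it pays for the one bad case, a bond that carries both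
discrepancies. For every other bond each of the two moves is a relocation that preserves the order
of the discrepancies, and they stay in `A`. -/
lemma IsDriftModular.resample {A : Set ℤ} {P Q b : ℝ} (hP : 0 ≤ P) (hQ : 0 ≤ Q) (hPQ : P + Q = 1)
    (hb : b = Q - P) {H : C(Config, ℝ)} (hH : IsDriftModular A b H) {w : ℤ}
    (hwA : w ∈ A) (hwA' : w + 1 ∈ A) :
    IsDriftModular A b (resample P Q (w, w + 1) H) := by
  have hw : w ≠ w + 1 := by omega
  have hR : ∀ σ a c, move w (w + 1) (update (update σ w a) (w + 1) c) =
      update (update σ w (a && c)) (w + 1) (a || c) := move_update_update_self hw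
  have hL : ∀ σ a c, move (w + 1) w (update (update σ w a) (w + 1) c) =
      update (update σ w (a || c)) (w + 1) (a && c) := by
    intro σ a c
    rw [Function.update_comm hw, move_update_update_self hw.symm, Function.update_comm hw,
      Bool.and_comm, Bool.or_comm]
  constructor
  · intro x y σ hx hy hxy
    simp only [resample_apply]
    by_cases h : x = w ∧ y = w + 1
    · obtain ⟨rfl, rfl⟩ := h
      simp [hR, hL]
    · obtain ⟨x1, y1, σ1, h1, hx1, hy1, e1⟩ :=
        exists_move_update_update (u := w) (v := w + 1) (.inl ⟨rfl, rfl⟩) hxy h σ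
      obtain ⟨x2, y2, σ2, h2, hx2, hy2, e2⟩ :=
        exists_move_update_update (u := w + 1) (v := w) (.inr ⟨rfl, rfl⟩) hxy h σ
      rw [e1, e1, e2, e2]
      have := hH.mono x1 y1 σ1 (by grind) (by grind) h1
      have := hH.mono x2 y2 σ2 (by grind) (by grind) h2
      gcongr
  · intro x y σ hx hy hxy
    simp only [resample_apply]
    by_cases h : x = w ∧ y = w + 1
    · obtain ⟨rfl, rfl⟩ := h
      simp only [hR, hL, Bool.and_true, Bool.or_true, Bool.and_false, Bool.or_false, Bool.or_self,
        Bool.and_self]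
      -- The new mixed difference is H(11) + H(00) - 2P H(01) - 2Q H(10), that is, the old one plus
      -- b (H(01) - H(10)). After multiplication by b the extra term is b² times an increment that
      -- is non-negative by `mono`.
      have h1 := hH.mono x (x + 1) σ hx hy hxy
      have h2 := hH.modular x (x + 1) σ hx hy hxy
      have hQ' : Q = 1 - P := by linarith
      subst hQ'
      have h3 : 0 ≤ b * b * (H (update (update σ x false) (x + 1) true) -
        H (update (update σ x true) (x + 1) false)) :=
        mul_nonneg (mul_self_nonneg b) (by linarith)
      have hb' : P = (1 - b) / 2 := by linarith
      subst hb'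
      nlinarith
    · obtain ⟨x1, y1, σ1, h1, hx1, hy1, e1⟩ :=
        exists_move_update_update (u := w) (v := w + 1) (.inl ⟨rfl, rfl⟩) hxy h σ
      obtain ⟨x2, y2, σ2, h2, hx2, hy2, e2⟩ :=
        exists_move_update_update (u := w + 1) (v := w) (.inr ⟨rfl, rfl⟩) hxy h σ
      rw [e1, e1, e1, e1, e2, e2, e2, e2]
      have k1 := mul_nonneg hP (hH.modular x1 y1 σ1 (by grind) (by grind) h1)
      have k2 := mul_nonneg hQ (hH.modular x2 y2 σ2 (by grind) (by grind) h2)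
      linarith

lemma IsDriftModular.sum {ι : Type*} {A : Set ℤ} {b : ℝ} (s : Finset ι) {H : ι → C(Config, ℝ)}
    (h : ∀ i ∈ s, IsDriftModular A b (H i)) : IsDriftModular A b (∑ i ∈ s, H i) := by
  constructor
  · intro x y σ hx hy hxy
    simp only [ContinuousMap.sum_apply]
    exact Finset.sum_le_sum fun i hi => (h i hi).mono x y σ hx hy hxy
  · intro x y σ hx hy hxy
    simp only [ContinuousMap.sum_apply]
    rw [← Finset.sum_sub_distrib, ← Finset.sum_sub_distrib, ← Finset.sum_add_distrib,
      Finset.mul_sum]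
    exact Finset.sum_nonneg fun i hi => (h i hi).modular x y σ hx hy hxy

lemma IsDriftModular.semigroup_modular {A : Set ℤ} {P Q b : ℝ} (hP : 0 ≤ P) (hQ : 0 ≤ Q) (hPQ : P + Q = 1)
    (hb : b = Q - P) {H : C(Config, ℝ)} (hH : IsDriftModular A b H) {s : Finset ℤ}
    (hs : ∀ w ∈ s, w ∈ A ∧ w + 1 ∈ A) {t : ℝ} (ht : 0 ≤ t) {x y : ℤ} (σ : Config)
    (hx : x ∈ A) (hy : y ∈ A) (hxy : x < y) :
    0 ≤ b * (semigroup P Q (lineBonds s) t H (update (update σ x true) y true) -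
      semigroup P Q (lineBonds s) t H (update (update σ x true) y false) -
      semigroup P Q (lineBonds s) t H (update (update σ x false) y true) +
      semigroup P Q (lineBonds s) t H (update (update σ x false) y false)) := by
  have h : ∀ k : ℕ, IsDriftModular A b ((resampleSum P Q (lineBonds s) ^ k) H) := by
    intro k
    induction k with
    | zero => simpa using hH
    | succ k ih =>
      rw [pow_succ', mul_apply_eq_comp, resampleSum, _root_.sum_apply,
        sum_lineBonds]
      exact IsDriftModular.sum s fun w hw => ih.resample hP hQ hPQ hb (hs w hw).1 (hs w hw).2
  exact dual_exp_nonneg (φ := b • (ContinuousMap.evalCLM ℝ (update (update σ x true) y true) -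
      ContinuousMap.evalCLM ℝ (update (update σ x true) y false) -
      ContinuousMap.evalCLM ℝ (update (update σ x false) y true) +
      ContinuousMap.evalCLM ℝ (update (update σ x false) y false)))
      (K := resampleSum P Q (lineBonds s)) (fun k => (h k).modular x y σ hx hy hxy) _ ht

end ExclusionProcess

namespace ExclusionProcess

open Function (update)

/-! ### The Bernoulli product measure -/

section Measure

variable (ρ : unitInterval)

instance : IsProbabilityMeasure (bernoulliProduct ρ) := by
  unfold bernoulliProduct; infer_instance

lemma integrable_config (μ : Measure Config) [IsFiniteMeasure μ] (f : C(Config, ℝ)) :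
    Integrable f μ :=
  Integrable.of_bound f.continuous.aestronglyMeasurable ‖f‖
    (Eventually.of_forall fun σ => f.norm_coe_le_norm σ)

lemma measurable_update_config (x : ℤ) (c : Bool) : Measurable fun σ : Config => update σ x c := by
  refine measurable_pi_iff.2 fun y => ?_
  simp only [Function.update_apply]
  split_ifs
  · exact measurable_const
  · exact measurable_pi_apply y

/-- Redrawing a single site leaves a product measure unchanged. This is checked on cylinders and is
the source of all the integrations by parts below. -/
lemma bernoulliProduct_eq_resample (x : ℤ) :
    bernoulliProduct ρ =
      unitInterval.toNNReal ρ • (bernoulliProduct ρ).map (fun σ => update σ x true) +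
      unitInterval.toNNReal (unitInterval.symm ρ) •
        (bernoulliProduct ρ).map (fun σ => update σ x false) := by
  symm
  refine Measure.eq_infinitePi _ fun s t ht => ?_
  have hm : ∀ c, ((bernoulliProduct ρ).map (fun σ : Config => update σ x c)) ((s : Set ℤ).pi t) =
      (if x ∈ s then Set.indicator (t x) 1 c else 1) *
        ∏ i ∈ s.erase x, (bernoulliMeasure true false ρ) (t i) := by
    intro c
    rw [Measure.map_apply (measurable_update_config x c)
      (MeasurableSet.pi s.countable_toSet fun i _ => ht i),
      ← Measure.infinitePi_pi (fun _ : ℤ => bernoulliMeasure true false ρ) (fun i _ => ht i)]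
    by_cases hc : x ∈ s ∧ c ∉ t x
    · rw [if_pos hc.1, Set.indicator_of_notMem hc.2, zero_mul]
      convert measure_empty (μ := bernoulliProduct ρ)
      ext σ
      simp only [Set.mem_preimage, Set.mem_pi, Set.mem_empty_iff_false, iff_false]
      intro h
      have := h x hc.1
      rw [Function.update_self] at this
      exact hc.2 this
    · have h1 : (if x ∈ s then Set.indicator (t x) (1 : Bool → ENNReal) c else 1) = 1 := by
        split_ifs with h
        · have : c ∈ t x := by tauto
          simp [this]
        · rfl
      rw [h1, one_mul]
      congr 1
      ext σ
      simp only [Set.mem_preimage, Set.mem_pi, Finset.coe_erase, Set.mem_sdiff,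
        Set.mem_singleton_iff]
      constructor
      · rintro h i ⟨hi, hix⟩
        simpa [Function.update_of_ne hix] using h i hi
      · intro h i hi
        by_cases hix : i = x
        · subst hix
          rw [Function.update_self]
          tauto
        · rw [Function.update_of_ne hix]
          exact h i ⟨hi, hix⟩
  rw [Measure.add_apply, Measure.smul_apply, Measure.smul_apply, hm, hm]
  by_cases hx : x ∈ s
  · rw [if_pos hx, if_pos hx, ← Finset.mul_prod_erase s _ hx, bernoulliMeasure_def,
      Measure.add_apply, Measure.smul_apply, Measure.smul_apply, Measure.dirac_apply' _ (ht x),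
      Measure.dirac_apply' _ (ht x), add_mul, smul_mul_assoc, smul_mul_assoc]
  · rw [if_neg hx, if_neg hx, Finset.erase_eq_of_notMem hx, ← add_smul]
    have : unitInterval.toNNReal ρ + unitInterval.toNNReal (unitInterval.symm ρ) = 1 := by
      ext; simp
    rw [this, one_smul, one_mul]

lemma integral_eq_resample (x : ℤ) (f : C(Config, ℝ)) :
    ∫ σ, f σ ∂bernoulliProduct ρ =
      ∫ σ, ((ρ : ℝ) * f (update σ x true) + (1 - ρ) * f (update σ x false))
        ∂bernoulliProduct ρ := by
  have hc : ∀ c, Continuous fun σ : Config => update σ x c := fun c => by fun_prop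
  have hi : ∀ c, Integrable (fun σ : Config => f (update σ x c)) (bernoulliProduct ρ) := fun c =>
    integrable_config _ (f.comp ⟨_, hc c⟩)
  rw [integral_add ((hi _).const_mul _) ((hi _).const_mul _), integral_const_mul,
    integral_const_mul]
  conv_lhs => rw [bernoulliProduct_eq_resample ρ x]
  rw [integral_add_measure, integral_smul_nnreal_measure, integral_smul_nnreal_measure,
    integral_map (measurable_update_config x _).aemeasurable f.continuous.aestronglyMeasurable,
    integral_map (measurable_update_config x _).aemeasurable f.continuous.aestronglyMeasurable]
  · simp [NNReal.smul_def]
  · exact integrable_config _ f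
  · exact integrable_config _ f

lemma continuous_occ (x : ℤ) : Continuous fun σ : Config => occ σ x := by
  unfold occ
  exact (continuous_of_discreteTopology (f := fun c : Bool => if c = true then (1 : ℝ) else 0)).comp
    (continuous_apply x)

lemma occ_update (σ : Config) (x y : ℤ) (c : Bool) :
    occ (update σ x c) y = if y = x then (if c then 1 else 0) else occ σ y := by
  unfold occ
  rw [Function.update_apply]
  split_ifs <;> simp_all

/-- The centered occupation variable `η_x - ρ`. -/
noncomputable def centered (x : ℤ) : C(Config, ℝ) := ⟨fun σ => occ σ x - ρ, by
  have := continuous_occ x; fun_prop⟩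

lemma centered_apply (x : ℤ) (σ : Config) : centered ρ x σ = occ σ x - ρ := rfl

lemma occ_mem (σ : Config) (x : ℤ) : occ σ x = 0 ∨ occ σ x = 1 := by
  unfold occ; split_ifs <;> simp

lemma abs_centered_le (x : ℤ) (σ : Config) : |centered ρ x σ| ≤ 1 := by
  rw [centered_apply, abs_le]
  have h0 := ρ.2.1
  have h1 := ρ.2.2
  rcases occ_mem σ x with h | h <;> rw [h] <;> constructor <;> linarith

/-- The correlation of two observables under the Bernoulli product measure. -/
noncomputable def pairing (g : C(Config, ℝ)) : C(Config, ℝ) →L[ℝ] ℝ :=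
  LinearMap.mkContinuous
    { toFun := fun f => ∫ σ, f σ * g σ ∂bernoulliProduct ρ
      map_add' := fun f₁ f₂ => by
        have := integral_add (integrable_config (bernoulliProduct ρ) (f₁ * g))
          (integrable_config _ (f₂ * g))
        simpa [add_mul] using this
      map_smul' := fun c f => by
        simp [← integral_const_mul, mul_assoc] } ‖g‖ fun f => by
    refine (norm_integral_le_of_norm_le_const (C := ‖g‖ * ‖f‖)
      (Eventually.of_forall fun σ => ?_)).trans ?_
    · rw [norm_mul, mul_comm]
      gcongr <;> exact ContinuousMap.norm_coe_le_norm _ _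
    · simp

lemma pairing_apply (f g : C(Config, ℝ)) :
    pairing ρ g f = ∫ σ, f σ * g σ ∂bernoulliProduct ρ := rfl

lemma pairing_comm (f g : C(Config, ℝ)) : pairing ρ g f = pairing ρ f g := by
  simp only [pairing_apply, mul_comm]

lemma norm_pairing_le (g : C(Config, ℝ)) : ‖pairing ρ g‖ ≤ ‖g‖ :=
  LinearMap.mkContinuous_norm_le _ (norm_nonneg _) _

/-- Integration against a centered occupation variable is integration of a difference. -/
lemma pairing_centered_mul (x : ℤ) (f g : C(Config, ℝ))
    (hg : ∀ σ c, g (update σ x c) = g σ) :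
    pairing ρ (centered ρ x * g) f = ρ * (1 - ρ) *
      ∫ σ, (f (update σ x true) - f (update σ x false)) * g σ ∂bernoulliProduct ρ := by
  rw [pairing_apply]
  have := integral_eq_resample ρ x (f * (centered ρ x * g))
  simp only [ContinuousMap.mul_apply] at this ⊢
  rw [this, ← integral_const_mul]
  congr 1
  ext σ
  simp only [centered_apply, occ_update, hg, if_true]
  simp
  ring

lemma pairing_centered (x : ℤ) (f : C(Config, ℝ)) :
    pairing ρ (centered ρ x) f = ρ * (1 - ρ) *
      ∫ σ, (f (update σ x true) - f (update σ x false)) ∂bernoulliProduct ρ := by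
  simpa using pairing_centered_mul ρ x f 1 (fun _ _ => rfl)

lemma centered_update_of_ne {x y : ℤ} (h : y ≠ x) (σ : Config) (c : Bool) :
    centered ρ y (update σ x c) = centered ρ y σ := by
  simp [centered_apply, occ_update, h]

/-- The one-site formula is applied at `x` and then at `y`. This is how the mixed differences of the
cone enter the correlations. -/
lemma pairing_centered_mul_centered {x y : ℤ} (h : x ≠ y) (f : C(Config, ℝ)) :
    pairing ρ (centered ρ x * centered ρ y) f = (ρ * (1 - ρ)) ^ 2 *
      ∫ σ, (f (update (update σ x true) y true) - f (update (update σ x true) y false) -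
        f (update (update σ x false) y true) + f (update (update σ x false) y false))
        ∂bernoulliProduct ρ := by
  rw [pairing_centered_mul ρ x f _ fun σ c => centered_update_of_ne ρ h.symm σ c]
  have hc : ∀ c, Continuous fun σ : Config => update σ x c := fun c => by fun_prop
  have := pairing_centered ρ y (f.comp ⟨_, hc true⟩ - f.comp ⟨_, hc false⟩)
  rw [pairing_apply] at this
  simp only [ContinuousMap.sub_apply, ContinuousMap.comp_apply, ContinuousMap.coe_mk] at this
  rw [this, sq, mul_assoc, mul_assoc, mul_assoc, mul_assoc, mul_assoc]
  congr 5
  ext σ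
  simp only [Function.update_comm h]
  ring

lemma chi_nonneg : 0 ≤ (ρ : ℝ) * (1 - ρ) := mul_nonneg ρ.2.1 (by linarith [ρ.2.2])

lemma chi_le_one : (ρ : ℝ) * (1 - ρ) ≤ 1 := by nlinarith [ρ.2.1, ρ.2.2]

lemma HasInfluence.nonneg {f : C(Config, ℝ)} {A : ℝ} {x₀ : ℤ} (hf : HasInfluence f A x₀) :
    0 ≤ A := by
  have := (abs_nonneg _).trans (hf x₀ (fun _ => true) true true)
  simpa [decay] using this

lemma HasInfluence.abs_pairing_le {f : C(Config, ℝ)} {A : ℝ} {x₀ : ℤ} (hf : HasInfluence f A x₀)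
    (x : ℤ) (g : C(Config, ℝ)) (hg : ∀ σ c, g (update σ x c) = g σ) (hg1 : ∀ σ, |g σ| ≤ 1) :
    |pairing ρ (centered ρ x * g) f| ≤ A * decay (x - x₀) := by
  rw [pairing_centered_mul ρ x f g hg, abs_mul, abs_of_nonneg (chi_nonneg ρ)]
  have h : |∫ σ, (f (update σ x true) - f (update σ x false)) * g σ ∂bernoulliProduct ρ| ≤
      A * decay (x - x₀) := by
    rw [← Real.norm_eq_abs]
    refine (norm_integral_le_of_norm_le_const (C := A * decay (x - x₀))
      (Eventually.of_forall fun σ => ?_)).trans (by simp)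
    rw [norm_mul, Real.norm_eq_abs, Real.norm_eq_abs]
    calc _ ≤ A * decay (x - x₀) * 1 := by
          gcongr
          · exact mul_nonneg hf.nonneg (decay_pos _).le
          · exact hf _ _ _ _
          · exact hg1 σ
      _ = _ := mul_one _
  calc _ ≤ 1 * (A * decay (x - x₀)) := by
        gcongr
        exact chi_le_one ρ
    _ = _ := one_mul _

lemma HasInfluence.abs_pairing_centered_le {f : C(Config, ℝ)} {A : ℝ} {x₀ : ℤ}
    (hf : HasInfluence f A x₀) (x : ℤ) : |pairing ρ (centered ρ x) f| ≤ A * decay (x - x₀) := by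
  simpa using hf.abs_pairing_le ρ x 1 (fun _ _ => rfl) (fun _ => by simp)

lemma HasInfluence.abs_pairing_centered_mul_le {f : C(Config, ℝ)} {A : ℝ} {x₀ : ℤ}
    (hf : HasInfluence f A x₀) {x y : ℤ} (hxy : x ≠ y) :
    |pairing ρ (centered ρ x * centered ρ y) f| ≤ A * decay (x - x₀) :=
  hf.abs_pairing_le ρ x _ (centered_update_of_ne ρ hxy.symm) (abs_centered_le ρ y)

lemma hasInfluence_centered (x : ℤ) : HasInfluence (centered ρ x) 1 x := by
  intro z σ c c'
  simp only [centered_apply, occ_update]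
  by_cases h : x = z
  · subst h
    cases c <;> cases c' <;> simp [decay, neg_sub_left]
  · simp [h, (decay_pos _).le]

/-- The constant 2 offsets the weight 1/2 of the site `x + 1` relative to `x`. -/
lemma hasInfluence_centered_mul (x : ℤ) :
    HasInfluence (centered ρ x * centered ρ (x + 1)) 2 x := by
  intro z σ c c'
  simp only [ContinuousMap.mul_apply]
  have hne : x + 1 ≠ x := by omega
  by_cases h : x = z
  · subst h
    rw [centered_update_of_ne ρ hne, centered_update_of_ne ρ hne, ← sub_mul, abs_mul]
    have h1 := hasInfluence_centered ρ x x σ c c'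
    have h2 := abs_centered_le ρ (x + 1) σ
    have h3 := decay_pos (x - x)
    nlinarith [abs_nonneg (centered ρ (x + 1) σ),
      abs_nonneg (centered ρ x (update σ x c) - centered ρ x (update σ x c'))]
  by_cases h' : x + 1 = z
  · subst h'
    rw [centered_update_of_ne ρ hne.symm, centered_update_of_ne ρ hne.symm, ← mul_sub, abs_mul]
    have h1 := hasInfluence_centered ρ (x + 1) (x + 1) σ c c'
    have h2 := abs_centered_le ρ x σ
    have h3 : decay (x + 1 - (x + 1)) ≤ 2 * decay (x + 1 - x) := decay_le_two_mul (by simp)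
    nlinarith [abs_nonneg (centered ρ x σ), decay_pos (x + 1 - x),
      abs_nonneg (centered ρ (x + 1) (update σ (x + 1) c) -
        centered ρ (x + 1) (update σ (x + 1) c'))]
  · simp [centered_update_of_ne ρ h, centered_update_of_ne ρ h', (decay_pos _).le]

lemma pairing_centered_centered (x y : ℤ) :
    pairing ρ (centered ρ x) (centered ρ y) = if y = x then (ρ : ℝ) * (1 - ρ) else 0 := by
  rw [pairing_centered]
  split_ifs with h
  · simp [centered_apply, occ_update, h]
  · simp [centered_apply, occ_update, h]

/-- A function of a single site has no mixed difference. -/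
lemma pairing_centered_mul_centered_centered {x y : ℤ} (hxy : x ≠ y) (z : ℤ) :
    pairing ρ (centered ρ x * centered ρ y) (centered ρ z) = 0 := by
  rw [pairing_centered_mul_centered ρ hxy]
  have : ∀ σ : Config, centered ρ z (update (update σ x true) y true) -
      centered ρ z (update (update σ x true) y false) -
      centered ρ z (update (update σ x false) y true) +
      centered ρ z (update (update σ x false) y false) = 0 := by
    intro σ
    simp only [centered_apply, occ_update]
    split_ifs <;> simp
  simp [this]

lemma pairing_centered_const (x : ℤ) (c : ℝ) :
    pairing ρ (centered ρ x) (ContinuousMap.const Config c) = 0 := by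
  rw [pairing_centered]; simp

/-! ### Time reversal -/

lemma integral_eq_resample_bond {u v : ℤ} (h : u ≠ v) (f : C(Config, ℝ)) :
    ∫ σ, f σ ∂bernoulliProduct ρ =
      ∫ σ, ((ρ : ℝ) * (ρ * f (update (update σ u true) v true) +
          (1 - ρ) * f (update (update σ u false) v true)) +
        (1 - ρ) * (ρ * f (update (update σ u true) v false) +
          (1 - ρ) * f (update (update σ u false) v false))) ∂bernoulliProduct ρ := by
  have hc : ∀ c, Continuous fun σ : Config => update σ v c := fun c => by fun_prop
  have hc' : ∀ c, Continuous fun σ : Config => update σ u c := fun c => by fun_prop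
  rw [integral_eq_resample ρ u f]
  have := integral_eq_resample ρ v ((ρ : ℝ) • f.comp ⟨_, hc' true⟩ +
    (1 - (ρ : ℝ)) • f.comp ⟨_, hc' false⟩)
  simp only [ContinuousMap.add_apply, ContinuousMap.smul_apply, ContinuousMap.comp_apply,
    ContinuousMap.coe_mk, smul_eq_mul] at this
  rw [this]
  simp only [Function.update_comm h]

/-- Only configurations with exactly one particle on the bond matter, and both have the same weight.
The defect of the duality between the rates (P, Q) and (Q, P) is a discrete gradient along the bond,
so it cancels once the bonds close up. -/
lemma pairing_resample_sub {P Q : ℝ} (hPQ : P + Q = 1) {e : ℤ × ℤ} (he : e.1 ≠ e.2)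
    (f g : C(Config, ℝ)) :
    pairing ρ g (resample P Q e f) - pairing ρ f (resample Q P e g) =
      (P - Q) * pairing ρ (centered ρ e.2 - centered ρ e.1) (f * g) := by
  obtain ⟨u, v⟩ := e
  simp only at he ⊢
  have hQ : Q = 1 - P := by linarith
  set F : C(Config, ℝ) := resample P Q (u, v) f * g - resample Q P (u, v) g * f -
    (P - Q) • (f * g * (centered ρ v - centered ρ u)) with hF
  have h0 : ∫ σ, F σ ∂bernoulliProduct ρ = 0 := by
    rw [integral_eq_resample_bond ρ he]
    have hm := fun σ a c => move_update_update_self he σ a c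
    have hm' : ∀ σ a c, move v u (update (update σ u a) v c) =
        update (update σ u (a || c)) v (a && c) := by
      intro σ a c
      rw [Function.update_comm he, move_update_update_self he.symm, Function.update_comm he,
        Bool.and_comm, Bool.or_comm]
    refine integral_eq_zero_of_ae (Eventually.of_forall fun σ => ?_)
    rw [Pi.zero_apply]
    simp only [hF, ContinuousMap.sub_apply, ContinuousMap.mul_apply, ContinuousMap.smul_apply,
      resample_apply, hm, hm', centered_apply, occ_update, he, smul_eq_mul, if_true, if_false]
    simp
    subst hQ
    ring
  have h1 : ∫ σ, F σ ∂bernoulliProduct ρ = pairing ρ g (resample P Q (u, v) f) -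
      pairing ρ f (resample Q P (u, v) g) -
      (P - Q) * pairing ρ (centered ρ v - centered ρ u) (f * g) := by
    simp only [pairing_apply]
    rw [← integral_const_mul, ← integral_sub, ← integral_sub]
    · rfl
    · exact integrable_config _ (resample P Q (u, v) f * g - resample Q P (u, v) g * f)
    · exact integrable_config _ ((P - Q) • (f * g * (centered ρ v - centered ρ u)))
    · exact integrable_config _ (resample P Q (u, v) f * g)
    · exact integrable_config _ (resample Q P (u, v) g * f)
  linarith

/-- On a system of bonds without boundary, time reversal exchanges the jump rates. -/
lemma pairing_semigroup_comm {P Q : ℝ} (hPQ : P + Q = 1) {B : Finset (ℤ × ℤ)}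
    (hB : ∀ e ∈ B, e.1 ≠ e.2) (hdiv : ∑ e ∈ B, (centered ρ e.2 - centered ρ e.1) = 0)
    (f g : C(Config, ℝ)) (t : ℝ) :
    pairing ρ g (semigroup P Q B t f) = pairing ρ f (semigroup Q P B t g) := by
  have h1 : ∀ f g, pairing ρ g (bondGen P Q B f) = pairing ρ f (bondGen Q P B g) := by
    intro f g
    have e1 : pairing ρ g (bondGen P Q B f) - pairing ρ f (bondGen Q P B g) =
        ∑ e ∈ B, (pairing ρ g (resample P Q e f) - pairing ρ f (resample Q P e g)) := by
      simp only [bondGen, resampleSum, sub_apply, map_sub, _root_.sum_apply, map_sum,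
        Finset.sum_sub_distrib, smul_apply, map_smul, one_apply_eq_self]
      rw [pairing_comm ρ f g]
      abel
    rw [← sub_eq_zero, e1, Finset.sum_congr rfl fun e he =>
      pairing_resample_sub ρ hPQ (hB e he) f g, ← Finset.mul_sum]
    have e2 : ∑ e ∈ B, pairing ρ (centered ρ e.2 - centered ρ e.1) (f * g) =
        pairing ρ (f * g) (∑ e ∈ B, (centered ρ e.2 - centered ρ e.1)) := by
      rw [map_sum]
      exact Finset.sum_congr rfl fun e _ => pairing_comm ρ _ _
    rw [e2, hdiv, map_zero, mul_zero]
  have h2 : ∀ (k : ℕ) f g, pairing ρ g ((bondGen P Q B ^ k) f) =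
      pairing ρ f ((bondGen Q P B ^ k) g) := by
    intro k
    induction k with
    | zero => intro f g; exact pairing_comm ρ f g
    | succ k ih =>
      intro f g
      rw [pow_succ', mul_apply_eq_comp, h1, pairing_comm, ih, pow_succ, mul_apply_eq_comp]
  exact dual_exp_smul_congr (fun k => h2 k f g) t

/-! ### Translation invariance -/

/-- The translation of configurations. -/
def shift (a : ℤ) : C(Config, Config) := ⟨fun σ x => σ (x + a), by fun_prop⟩

lemma map_shift_bernoulliProduct (a : ℤ) :
    (bernoulliProduct ρ).map (shift a) = bernoulliProduct ρ := by
  have := Measure.infinitePi_map_piCongrLeft (fun _ : ℤ => bernoulliMeasure true false ρ)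
    (Equiv.subRight a)
  convert! this using 2
  ext σ x
  have h := Equiv.piCongrLeft_apply_apply (fun _ : ℤ => Bool) (Equiv.subRight a) σ (x + a)
  rw [Equiv.subRight_apply, add_sub_cancel_right] at h
  exact h.symm

lemma pairing_shift (a : ℤ) (f g : C(Config, ℝ)) :
    pairing ρ (compOp (shift a) g) (compOp (shift a) f) = pairing ρ g f := by
  rw [pairing_apply, pairing_apply]
  conv_rhs => rw [← map_shift_bernoulliProduct ρ a]
  exact (integral_map (shift a).continuous.measurable.aemeasurable
    (f * g).continuous.aestronglyMeasurable).symm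

lemma compOp_shift_centered (a x : ℤ) :
    compOp (shift a) (centered ρ x) = centered ρ (x + a) := rfl

lemma move_shift (a u v : ℤ) (σ : Config) :
    move u v (shift a σ) = shift a (move (u + a) (v + a) σ) := by
  ext x
  simp [move_apply, shift]

lemma compOp_shift_semigroup (P Q : ℝ) (a : ℤ) (s : Finset ℤ) (f : C(Config, ℝ)) (t : ℝ) :
    compOp (shift a) (semigroup P Q (lineBonds s) t f) =
      semigroup P Q (lineBonds (s.map (Equiv.addRight a).toEmbedding)) t
        (compOp (shift a) f) := by
  have h1 : ∀ f, compOp (shift a) (bondGen P Q (lineBonds s) f) =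
      bondGen P Q (lineBonds (s.map (Equiv.addRight a).toEmbedding)) (compOp (shift a) f) := by
    intro f
    ext σ
    rw [compOp_apply, bondGen_apply, bondGen_apply, sum_lineBonds, sum_lineBonds, Finset.sum_map]
    refine Finset.sum_congr rfl fun x _ => ?_
    simp only [resample_apply, move_shift, compOp_apply, Equiv.coe_toEmbedding,
      Equiv.coe_addRight, add_right_comm x 1 a]
  have h2 : ∀ (k : ℕ) f, compOp (shift a) ((bondGen P Q (lineBonds s) ^ k) f) =
      (bondGen P Q (lineBonds (s.map (Equiv.addRight a).toEmbedding)) ^ k)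
        (compOp (shift a) f) := by
    intro k
    induction k with
    | zero => intro f; rfl
    | succ k ih => intro f; rw [pow_succ', mul_apply_eq_comp, h1, ih, pow_succ', mul_apply_eq_comp]
  ext σ
  exact dual_exp_smul_congr (φ := (ContinuousMap.evalCLM ℝ σ).comp (compOp (shift a)))
    (ψ := ContinuousMap.evalCLM ℝ σ) (fun k => congrArg (fun h => h σ) (h2 k f)) t

/-! ### Comparison of different systems of bonds -/

/-- The additional bonds act on a function that hardly depends on their endpoints when these are far
from `x₀`. -/
lemma norm_bondGen_sub_le {P Q : ℝ} (hP : 0 ≤ P) (hQ : 0 ≤ Q) (hPQ : P + Q = 1)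
    {f : C(Config, ℝ)} {A : ℝ} {x₀ : ℤ} (hf : HasInfluence f A x₀) {B B' : Finset (ℤ × ℤ)}
    (hB : B ⊆ B') :
    ‖bondGen P Q B' f - bondGen P Q B f‖ ≤
      A * ∑ e ∈ B' \ B, (decay (e.1 - x₀) + decay (e.2 - x₀)) := by
  have h0 : 0 ≤ A * ∑ e ∈ B' \ B, (decay (e.1 - x₀) + decay (e.2 - x₀)) :=
    mul_nonneg hf.nonneg (Finset.sum_nonneg fun e _ =>
      add_nonneg (decay_pos _).le (decay_pos _).le)
  refine (ContinuousMap.norm_le _ h0).2 fun σ => ?_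
  rw [ContinuousMap.sub_apply, bondGen_apply, bondGen_apply, ← Finset.sum_sdiff hB,
    add_sub_cancel_right, Finset.mul_sum]
  refine (norm_sum_le _ _).trans (Finset.sum_le_sum fun e _ => ?_)
  exact abs_resample_sub_le_of_hasInfluence hP hQ hPQ hf e σ

lemma abs_pairing_semigroup_sub_le {P Q : ℝ} (hP : 0 ≤ P) (hQ : 0 ≤ Q) (hPQ : P + Q = 1)
    {f : C(Config, ℝ)} {A : ℝ} {x₀ : ℤ} (hf : HasInfluence f A x₀) {s : Finset ℤ}
    {B' : Finset (ℤ × ℤ)} (hB : lineBonds s ⊆ B') (g : C(Config, ℝ)) {t : ℝ} (ht : 0 ≤ t) :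
    |pairing ρ g (semigroup P Q B' t f) - pairing ρ g (semigroup P Q (lineBonds s) t f)| ≤
      t * (‖g‖ * (Real.exp (2 * t) * A *
        ∑ e ∈ B' \ lineBonds s, (decay (e.1 - x₀) + decay (e.2 - x₀)))) := by
  set S : ℝ := ∑ e ∈ B' \ lineBonds s, (decay (e.1 - x₀) + decay (e.2 - x₀))
  have hS : 0 ≤ S := Finset.sum_nonneg fun e _ => add_nonneg (decay_pos _).le (decay_pos _).le
  have hA := hf.nonneg
  -- Time is frozen at 0 for negative `r`, because the Duhamel estimate asks for a norm bound at all
  -- real times and the semigroup is a contraction only forward in time.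
  set U : ℝ → C(Config, ℝ) →L[ℝ] ℝ := fun r => (pairing ρ g).comp (semigroup P Q B' (max r 0))
    with hU
  have hbound : ∀ r (h : C(Config, ℝ)), |U r h| ≤ ‖g‖ * ‖h‖ := fun r h =>
    (((pairing ρ g).le_of_opNorm_le (norm_pairing_le ρ g) _).trans
      (mul_le_mul_of_nonneg_left (norm_semigroup_le hP hQ hPQ B' (le_max_right _ _) h)
        (norm_nonneg _)))
  have hder : ∀ s (h : C(Config, ℝ)), 0 ≤ s →
      HasDerivWithinAt (fun r => U r h) (U s (bondGen P Q B' h)) (Set.Ici s) s := by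
    intro s h hs
    have h1 := (pairing ρ g).hasFDerivAt.comp_hasDerivAt s
      (hasDerivAt_exp_smul_apply (bondGen P Q B') h s)
    have h2 : U s (bondGen P Q B' h) =
        pairing ρ g (opSemigroup (bondGen P Q B') s (bondGen P Q B' h)) := by
      simp [hU, max_eq_left hs, semigroup]
    rw [h2]
    refine h1.hasDerivWithinAt.congr_of_eventuallyEq ?_ ?_
    · filter_upwards [self_mem_nhdsWithin] with r hr
      simp [hU, max_eq_left (hs.trans hr), semigroup]
    · simp [hU, max_eq_left hs, semigroup]
  have hcont : ∀ h : C(Config, ℝ), Continuous fun r => U r h := by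
    intro h
    have h1 : Continuous fun r => semigroup P Q B' r h := continuous_iff_continuousAt.2 fun r =>
      (hasDerivAt_exp_smul_apply (bondGen P Q B') h r).continuousAt
    exact (pairing ρ g).continuous.comp (h1.comp (continuous_id.max continuous_const))
  have key := abs_dual_sub_exp_le (U := U) (C := ‖g‖)
    (fun r => ContinuousLinearMap.opNorm_le_bound _ (norm_nonneg _) (hbound r))
    (bondGen P Q (lineBonds s)) f (δ := ‖g‖ * (Real.exp (2 * t) * A * S)) ht
    (fun r _ _ => ⟨(hcont _).continuousOn, (hcont _).continuousOn⟩) ?_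
  · have e0 : U 0 (opSemigroup (bondGen P Q (lineBonds s)) t f) =
        pairing ρ g (semigroup P Q (lineBonds s) t f) := by
      simp only [hU, max_self, ContinuousLinearMap.comp_apply, semigroup_zero]
      rfl
    have et : U t f = pairing ρ g (semigroup P Q B' t f) := by
      simp [hU, max_eq_left ht]
    rw [e0, et] at key
    exact key
  · intro r hr hrt
    refine ⟨_, hder r _ hr, ?_⟩
    rw [← map_sub]
    refine (hbound r _).trans (mul_le_mul_of_nonneg_left ?_ (norm_nonneg _))
    refine (norm_bondGen_sub_le hP hQ hPQ
      (HasInfluence.semigroup hP hQ hPQ hA hf s (sub_nonneg.2 hrt.le)) hB).trans ?_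
    gcongr
    linarith

end Measure

end ExclusionProcess

namespace ExclusionProcess

open Function (update)

/-! ### The generator on local functions -/

/-- `move` is idle exactly when the exclusion rule forbids the jump or the source is empty, so it
absorbs the rate factor. -/
lemma occ_mul_exchange_sub (u v : ℤ) (σ : Config) (f : Config → ℝ) :
    occ σ u * (1 - occ σ v) * (f (exchange σ u v) - f σ) = f (move u v σ) - f σ := by
  unfold occ
  cases hu : σ u <;> cases hv : σ v
  · have : move u v σ = σ := by
      ext x; rw [move_apply]; split_ifs <;> simp_all
    simp [this]
  · have : move u v σ = σ := by
      ext x; rw [move_apply]; split_ifs <;> simp_all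
    simp [this]
  · have : move u v σ = exchange σ u v := by
      ext x
      rw [move_apply, exchange, Equiv.swap_apply_def]
      split_ifs <;> simp_all
    simp [this]
  · have : move u v σ = σ := by
      ext x; rw [move_apply]; split_ifs <;> simp_all
    simp [this]

lemma jump_add_eq_one {p : ℤ → ℝ} (hp : IsJumpLaw p) (hnn : ∀ z : ℤ, |z| ≠ 1 → p z = 0) :
    p 1 + p (-1) = 1 := by
  rw [← hp.sum_eq_one, tsum_eq_sum (s := {1, -1}) fun z hz => hnn z ?_]
  · rw [Finset.sum_pair (by norm_num)]
  · simp only [Finset.mem_insert, Finset.mem_singleton, not_or] at hz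
    intro h
    rcases (abs_eq (by norm_num)).1 h with h | h <;> tauto

lemma drift_eq {p : ℤ → ℝ} (hnn : ∀ z : ℤ, |z| ≠ 1 → p z = 0) :
    drift p = p 1 - p (-1) := by
  rw [drift, tsum_eq_sum (s := {1, -1}) fun z hz => ?_]
  · rw [Finset.sum_pair (by norm_num)]; push_cast; ring
  · simp only [Finset.mem_insert, Finset.mem_singleton, not_or] at hz
    rw [hnn z, mul_zero]
    intro h
    rcases (abs_eq (by norm_num)).1 h with h | h <;> tauto

/-- On functions of the sites in `[-m, m]` only the bonds that touch this interval act. -/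
lemma generator_eq_bondGen {p : ℤ → ℝ} (hp : IsJumpLaw p) (hnn : ∀ z : ℤ, |z| ≠ 1 → p z = 0)
    {m : ℤ} {f : C(Config, ℝ)} (hf : DependsOn f (Set.Icc (-m) m)) (σ : Config) :
    generator p f σ = bondGen (p 1) (p (-1)) (lineBonds (Finset.Icc (-m - 1) m)) f σ := by
  set s := Finset.Icc (-m - 1) m with hs
  -- `S` collects the jumps to the right and `S'` those to the left over the same bonds; a left jump
  -- starts at the right endpoint `x + 1`.
  set S : Finset (ℤ × ℤ) := s.image fun x => (x, 1) with hS
  set S' : Finset (ℤ × ℤ) := s.image fun x => (x + 1, -1) with hS'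
  have hdisj : Disjoint S S' := by
    rw [Finset.disjoint_left]
    intro q h1 h2
    simp only [hS, hS', Finset.mem_image] at h1 h2
    obtain ⟨a, _, rfl⟩ := h1
    obtain ⟨c, _, h⟩ := h2
    have := (Prod.ext_iff.1 h).2
    norm_num at this
  rw [generator, tsum_eq_sum (s := S ∪ S') fun q hq => ?_, Finset.sum_union hdisj, hS, hS',
    Finset.sum_image (by intro x _ y _ h; simpa using h),
    Finset.sum_image (by intro x _ y _ h; simpa using h), ← Finset.sum_add_distrib,
    bondGen_apply, sum_lineBonds]
  · refine Finset.sum_congr rfl fun x _ => ?_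
    simp only [resample_apply, add_neg_cancel_right]
    have e1 := occ_mul_exchange_sub x (x + 1) σ f
    have e2 := occ_mul_exchange_sub (x + 1) x σ f
    have e3 := jump_add_eq_one hp hnn
    linear_combination p 1 * e1 + p (-1) * e2 - f σ * e3
  · obtain ⟨x, z⟩ := q
    simp only
    by_cases hz : |z| = 1
    · have hmem : ∀ y ∈ Set.Icc (-m) m, ¬(y = x ∨ y = x + z) := by
        intro y hy h
        rw [Set.mem_Icc] at hy
        refine hq (Finset.mem_union.2 ?_)
        simp only [hS, hS', hs, Finset.mem_image, Finset.mem_Icc]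
        rcases (abs_eq (by norm_num)).1 hz with rfl | rfl
        · exact Or.inl ⟨x, by omega, rfl⟩
        · exact Or.inr ⟨x - 1, by omega, by simp⟩
      have : f (exchange σ x (x + z)) = f σ := by
        refine hf fun y hy => ?_
        have := hmem y hy
        unfold exchange
        rw [Equiv.swap_apply_of_ne_of_ne] <;> tauto
      rw [this]; ring
    · rw [hnn z hz]; ring

lemma dependsOn_bondGen {P Q : ℝ} {B : Finset (ℤ × ℤ)} {A : Set ℤ}
    (hB : ∀ e ∈ B, e.1 ∈ A ∧ e.2 ∈ A) {f : C(Config, ℝ)} (hf : DependsOn f A) :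
    DependsOn (bondGen P Q B f) A := by
  intro σ τ hστ
  rw [bondGen_apply, bondGen_apply]
  refine Finset.sum_congr rfl fun e he => ?_
  have h1 := hστ _ (hB e he).1
  have h2 := hστ _ (hB e he).2
  rw [resample_apply, resample_apply, hf hστ]
  congr 3 <;>
  · refine hf fun x hx => ?_
    simp only [move_apply, h1, h2, hστ x hx]

/-! ### Correlations of the process -/

section Correlations

variable {Ω : Type*} [MeasurableSpace Ω] {P : Measure Ω}
  {ℱ : Filtration ℝ≥0 (inferInstance : MeasurableSpace Ω)} {p : ℤ → ℝ} {ρ : unitInterval}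
  {η : ℝ≥0 → Ω → Config}

lemma IsExclusionProcess.measurable (hη : IsExclusionProcess P ℱ p η) (t : ℝ≥0) :
    Measurable (η t) := (hη.adapted t).mono (ℱ.le t) le_rfl

/-- Right-continuity makes the process a limit of its values at grid times, which depend on time
through countably many values only. -/
lemma IsExclusionProcess.measurable_uncurry (hη : IsExclusionProcess P ℱ p η)
    (f : C(Config, ℝ)) : Measurable fun q : ℝ × Ω => f (η q.1.toNNReal q.2) := by
  have h1 : Measurable fun q : ℝ≥0 × Ω => f (η q.1 q.2) := by
    have hgrid : ∀ (e : ℕ → ℝ≥0) (k : ℝ≥0 → ℕ), Measurable k →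
        Measurable fun q : ℝ≥0 × Ω => f (η (e (k q.1)) q.2) := by
      intro e k hk
      have h2 : Measurable fun q : ℕ × Ω => f (η (e q.1) q.2) :=
        measurable_from_prod_countable_right fun k => f.continuous.measurable.comp
          (hη.measurable (e k))
      have h3 : Measurable fun q : ℝ≥0 × Ω => (k q.1, q.2) :=
        (hk.comp measurable_fst).prodMk measurable_snd
      exact h2.comp h3
    -- The floor plus one gives a grid point strictly to the right of the time, within distance 1/(n
    -- + 1).
    have ha : ∀ n : ℕ, Measurable fun q : ℝ≥0 × Ω =>
        f (η ((⌊(n + 1 : ℝ≥0) * q.1⌋₊ + 1 : ℝ≥0) / (n + 1)) q.2) := fun n =>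
      hgrid (fun k => (k + 1 : ℝ≥0) / (n + 1)) (fun r => ⌊(n + 1 : ℝ≥0) * r⌋₊)
        (Nat.measurable_floor.comp (measurable_const.mul measurable_id))
    refine measurable_of_tendsto_metrizable ha (tendsto_pi_nhds.2 fun q => ?_)
    obtain ⟨r, ω⟩ := q
    have hlim : Tendsto (fun n : ℕ => ((⌊(n + 1 : ℝ≥0) * r⌋₊ + 1 : ℝ≥0) / (n + 1))) atTop
        (𝓝[Set.Ici r] r) := by
      refine tendsto_nhdsWithin_iff.2 ⟨?_, Eventually.of_forall fun n => ?_⟩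
      · have hup : Tendsto (fun n : ℕ => r + 1 / ((n : ℝ≥0) + 1)) atTop (𝓝 (r + 0)) :=
          tendsto_const_nhds.add tendsto_one_div_add_atTop_nhds_zero_nat
        rw [add_zero] at hup
        refine tendsto_of_tendsto_of_tendsto_of_le_of_le tendsto_const_nhds hup (fun n => ?_)
          fun n => ?_
        · change r ≤ _
          rw [le_div_iff₀ (by positivity), mul_comm]
          exact (Nat.lt_floor_add_one _).le
        · change _ ≤ r + 1 / ((n : ℝ≥0) + 1)
          have hn : ((n : ℝ≥0) + 1) ≠ 0 := by positivity
          have h4 : (⌊(n + 1 : ℝ≥0) * r⌋₊ : ℝ≥0) ≤ (n + 1) * r := Nat.floor_le zero_le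
          rw [div_le_iff₀ (by positivity), add_mul r, one_div_mul_cancel hn, mul_comm r]
          gcongr
      · rw [Set.mem_Ici, le_div_iff₀ (by positivity), mul_comm]
        exact (Nat.lt_floor_add_one _).le
    exact (f.continuous.tendsto _).comp ((hη.right_continuous ω r).tendsto.comp hlim)
  exact h1.comp (measurable_real_toNNReal.comp measurable_fst |>.prodMk measurable_snd)

variable [IsProbabilityMeasure P]

/-- The correlation of an observable at time `t` with an observable at time `0`, as a functional
of the former. -/
noncomputable def timeCorr (P : Measure Ω) [IsProbabilityMeasure P] (η : ℝ≥0 → Ω → Config)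
    (hm : ∀ t, Measurable (η t)) (g : C(Config, ℝ)) (t : ℝ) : C(Config, ℝ) →L[ℝ] ℝ :=
  LinearMap.mkContinuous
    { toFun := fun f => ∫ ω, f (η t.toNNReal ω) * g (η 0 ω) ∂P
      map_add' := fun f₁ f₂ => by
        have hi : ∀ f : C(Config, ℝ),
            Integrable (fun ω => f (η t.toNNReal ω) * g (η 0 ω)) P := fun f =>
          Integrable.of_bound ((f.continuous.measurable.comp (hm _)).mul
            (g.continuous.measurable.comp (hm _))).aestronglyMeasurable (‖f‖ * ‖g‖)
            (Eventually.of_forall fun ω => by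
              rw [norm_mul]
              gcongr <;> exact ContinuousMap.norm_coe_le_norm _ _)
        rw [← integral_add (hi f₁) (hi f₂)]
        simp [add_mul]
      map_smul' := fun c f => by
        simp [← integral_const_mul, mul_assoc] } ‖g‖ fun f => by
    refine (norm_integral_le_of_norm_le_const (C := ‖g‖ * ‖f‖)
      (Eventually.of_forall fun σ => ?_)).trans ?_
    · rw [norm_mul, mul_comm]
      gcongr <;> exact ContinuousMap.norm_coe_le_norm _ _
    · simp

lemma timeCorr_apply (hm : ∀ t, Measurable (η t)) (g : C(Config, ℝ)) (t : ℝ) (f : C(Config, ℝ)) :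
    timeCorr P η hm g t f = ∫ ω, f (η t.toNNReal ω) * g (η 0 ω) ∂P := rfl

lemma norm_timeCorr_le (hm : ∀ t, Measurable (η t)) (g : C(Config, ℝ)) (t : ℝ) :
    ‖timeCorr P η hm g t‖ ≤ ‖g‖ := LinearMap.mkContinuous_norm_le _ (norm_nonneg _) _

lemma integrable_uncurry_mul (hη : IsExclusionProcess P ℱ p η) (f g : C(Config, ℝ))
    (μ : Measure ℝ) [IsFiniteMeasure μ] :
    Integrable (fun q : ℝ × Ω => f (η q.1.toNNReal q.2) * g (η 0 q.2)) (μ.prod P) :=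
  Integrable.of_bound ((hη.measurable_uncurry f).mul (g.continuous.measurable.comp
      ((hη.measurable 0).comp measurable_snd))).aestronglyMeasurable (‖f‖ * ‖g‖)
    (Eventually.of_forall fun ω => by
      rw [norm_mul]
      gcongr <;> exact ContinuousMap.norm_coe_le_norm _ _)

lemma measurable_timeCorr (hη : IsExclusionProcess P ℱ p η) (g f : C(Config, ℝ)) :
    Measurable fun r => timeCorr P η hη.measurable g r f := by
  have h1 : StronglyMeasurable fun q : ℝ × Ω => f (η q.1.toNNReal q.2) * g (η 0 q.2) :=
    ((hη.measurable_uncurry f).mul (g.continuous.measurable.comp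
      ((hη.measurable 0).comp measurable_snd))).stronglyMeasurable
  exact h1.integral_prod_right.measurable

lemma intervalIntegrable_timeCorr (hη : IsExclusionProcess P ℱ p η) (g f : C(Config, ℝ))
    (a b : ℝ) : IntervalIntegrable (fun r => timeCorr P η hη.measurable g r f) volume a b := by
  rw [intervalIntegrable_iff]
  have : IsFiniteMeasure (volume.restrict (Set.uIoc a b)) :=
    isFiniteMeasure_restrict.2 measure_Ioc_lt_top.ne
  refine Integrable.of_bound (measurable_timeCorr hη g f).aestronglyMeasurable (‖g‖ * ‖f‖)
    (Eventually.of_forall fun r => ?_)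
  exact ContinuousLinearMap.le_of_opNorm_le _ (norm_timeCorr_le _ g r) f

/-- The forward equation of the correlations of local observables. -/
lemma timeCorr_sub_eq_integral (hη : IsExclusionProcess P ℱ p η) (hp : IsJumpLaw p)
    (hnn : ∀ z : ℤ, |z| ≠ 1 → p z = 0) {m : ℤ} {f : C(Config, ℝ)}
    (hf : DependsOn f (Set.Icc (-m) m)) (g : C(Config, ℝ)) {t : ℝ} (ht : 0 ≤ t) :
    timeCorr P η hη.measurable g t f - timeCorr P η hη.measurable g 0 f =
      ∫ s in (0 : ℝ)..t, timeCorr P η hη.measurable g s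
        (bondGen (p 1) (p (-1)) (lineBonds (Finset.Icc (-m - 1) m)) f) := by
  set h := bondGen (p 1) (p (-1)) (lineBonds (Finset.Icc (-m - 1) m)) f with hh
  lift t to ℝ≥0 using ht
  have hmart := hη.martingale f ⟨Finset.Icc (-m) m, by simpa using hf⟩
  have hgen : ∀ σ, generator p f σ = h σ := generator_eq_bondGen hp hnn hf
  simp only [hgen] at hmart
  set M : ℝ≥0 → Ω → ℝ := fun t ω => f (η t ω) - f (η 0 ω) -
    ∫ s in (0 : ℝ)..(t : ℝ), h (η s.toNNReal ω) with hM
  set G : Ω → ℝ := fun ω => g (η 0 ω) with hG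
  have hGm : Measurable[ℱ 0] G := g.continuous.measurable.comp (hη.adapted 0)
  have hGb : ∀ ω, ‖G ω‖ ≤ ‖g‖ := fun ω => g.norm_coe_le_norm _
  have hMi : Integrable (M t) P := hmart.integrable t
  have hMG : Integrable (M t * G) P :=
    hMi.mul_bdd (hGm.mono (ℱ.le 0) le_rfl).aestronglyMeasurable (Eventually.of_forall hGb)
  -- `G` is known at time 0 and the martingale starts at 0, so conditioning on ℱ₀ kills the product.
  have hzero : ∫ ω, (M t * G) ω ∂P = 0 := by
    rw [← integral_condExp (ℱ.le 0)]
    refine integral_eq_zero_of_ae ?_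
    have h1 := condExp_mul_of_stronglyMeasurable_right hGm.stronglyMeasurable hMG hMi
    filter_upwards [h1, hmart.2 0 t zero_le] with ω e1 e2
    rw [e1, Pi.mul_apply, e2]
    simp [hM]
  have hfi : ∀ r : ℝ≥0, Integrable (fun ω => f (η r ω) * G ω) P := fun r =>
    Integrable.of_bound ((f.continuous.measurable.comp (hη.measurable r)).mul
      (hGm.mono (ℱ.le 0) le_rfl)).aestronglyMeasurable (‖f‖ * ‖g‖)
      (Eventually.of_forall fun ω => by
        rw [norm_mul]
        gcongr
        · exact ContinuousMap.norm_coe_le_norm _ _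
        · exact hGb ω)
  have hprod := integrable_uncurry_mul hη h g (volume.restrict (Set.Ioc 0 (t : ℝ)))
  have hI : Integrable (fun ω => (∫ s in (0 : ℝ)..(t : ℝ), h (η s.toNNReal ω)) * G ω) P := by
    simp only [intervalIntegral.integral_of_le t.coe_nonneg, ← integral_mul_const]
    exact hprod.integral_prod_right
  have hswap : ∫ ω, (∫ s in (0 : ℝ)..(t : ℝ), h (η s.toNNReal ω)) * G ω ∂P =
      ∫ s in (0 : ℝ)..t, timeCorr P η hη.measurable g s h := by
    simp only [intervalIntegral.integral_of_le t.coe_nonneg, ← integral_mul_const]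
    exact (integral_integral_swap (f := fun (s : ℝ) ω => h (η s.toNNReal ω) * G ω) hprod).symm
  rw [← hswap, timeCorr_apply, timeCorr_apply, Real.toNNReal_coe, Real.toNNReal_zero]
  have hsplit : ∫ ω, (M t * G) ω ∂P = ∫ ω, f (η t ω) * G ω ∂P - ∫ ω, f (η 0 ω) * G ω ∂P -
      ∫ ω, (∫ s in (0 : ℝ)..(t : ℝ), h (η s.toNNReal ω)) * G ω ∂P := by
    have e1 := integral_sub (hfi t) (hfi 0)
    have e2 := integral_sub ((hfi t).sub (hfi 0)) hI
    simp only [Pi.sub_apply] at e2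
    rw [← e1, ← e2]
    congr 1
    ext ω
    simp only [hM, Pi.mul_apply]
    ring
  linarith

lemma continuous_timeCorr (hη : IsExclusionProcess P ℱ p η) (hp : IsJumpLaw p)
    (hnn : ∀ z : ℤ, |z| ≠ 1 → p z = 0) {m : ℤ} {f : C(Config, ℝ)}
    (hf : DependsOn f (Set.Icc (-m) m)) (g : C(Config, ℝ)) :
    Continuous fun r => timeCorr P η hη.measurable g r f := by
  have h1 := intervalIntegral.continuous_primitive (intervalIntegrable_timeCorr hη g
    (bondGen (p 1) (p (-1)) (lineBonds (Finset.Icc (-m - 1) m)) f)) 0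
  -- Negative times are sent to 0 by `toNNReal`, hence the `max r 0`.
  have h2 : (fun r => timeCorr P η hη.measurable g r f) = fun r =>
      timeCorr P η hη.measurable g 0 f + ∫ s in (0 : ℝ)..max r 0, timeCorr P η hη.measurable g s
        (bondGen (p 1) (p (-1)) (lineBonds (Finset.Icc (-m - 1) m)) f) := by
    ext r
    rw [← timeCorr_sub_eq_integral hη hp hnn hf g (le_max_right r 0), add_sub_cancel]
    simp only [timeCorr_apply, Real.toNNReal, max_assoc, max_self]
  rw [h2]
  exact continuous_const.add (h1.comp (continuous_id.max continuous_const))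

lemma hasDerivWithinAt_timeCorr (hη : IsExclusionProcess P ℱ p η) (hp : IsJumpLaw p)
    (hnn : ∀ z : ℤ, |z| ≠ 1 → p z = 0) {m : ℤ} {f : C(Config, ℝ)}
    (hf : DependsOn f (Set.Icc (-m) m)) (g : C(Config, ℝ)) {s : ℝ} (hs : 0 ≤ s) :
    HasDerivWithinAt (fun r => timeCorr P η hη.measurable g r f)
      (timeCorr P η hη.measurable g s
        (bondGen (p 1) (p (-1)) (lineBonds (Finset.Icc (-m - 1) m)) f)) (Set.Ici s) s := by
  set h := bondGen (p 1) (p (-1)) (lineBonds (Finset.Icc (-m - 1) m)) f with hh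
  -- The generator enlarges the support by one site on either side.
  have hdep : DependsOn h (Set.Icc (-(m + 1)) (m + 1)) := by
    refine dependsOn_bondGen (fun e he => ?_) (hf.mono (Set.Icc_subset_Icc (by omega) (by omega)))
    rw [mem_lineBonds, Finset.mem_Icc] at he
    simp only [Set.mem_Icc]
    omega
  have h1 := intervalIntegral.integral_hasDerivAt_right (intervalIntegrable_timeCorr hη g h 0 s)
    (measurable_timeCorr hη g h).stronglyMeasurable.stronglyMeasurableAtFilter
    (continuous_timeCorr hη hp hnn hdep g).continuousAt
  have h2 := (h1.const_add (timeCorr P η hη.measurable g 0 f)).hasDerivWithinAt (s := Set.Ici s)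
  refine h2.congr_of_eventuallyEq ?_ ?_
  · filter_upwards [self_mem_nhdsWithin] with r hr
    rw [← timeCorr_sub_eq_integral hη hp hnn hf g (hs.trans hr), add_sub_cancel]
  · rw [← timeCorr_sub_eq_integral hη hp hnn hf g hs, add_sub_cancel]

/-- The semigroup of the bonds inside [-m, m] keeps the support in [-m, m], where the forward
equation of the process holds. The two evolutions then differ only through the bonds at the ends of
the interval. -/
lemma abs_timeCorr_sub_le (hη : IsExclusionProcess P ℱ p η) (hp : IsJumpLaw p)
    (hnn : ∀ z : ℤ, |z| ≠ 1 → p z = 0) {m : ℤ} {f : C(Config, ℝ)} {A : ℝ} {x₀ : ℤ}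
    (hf : DependsOn f (Set.Icc (-m) m)) (hfA : HasInfluence f A x₀)
    (g : C(Config, ℝ)) {t : ℝ} (ht : 0 ≤ t) :
    |timeCorr P η hη.measurable g t f - timeCorr P η hη.measurable g 0
        (semigroup (p 1) (p (-1)) (lineBonds (Finset.Ico (-m) m)) t f)| ≤
      t * (‖g‖ * (Real.exp (2 * t) * A *
        ∑ e ∈ lineBonds (Finset.Icc (-m - 1) m) \ lineBonds (Finset.Ico (-m) m),
          (decay (e.1 - x₀) + decay (e.2 - x₀)))) := by
  set S : ℝ := ∑ e ∈ lineBonds (Finset.Icc (-m - 1) m) \ lineBonds (Finset.Ico (-m) m),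
    (decay (e.1 - x₀) + decay (e.2 - x₀))
  have hS : 0 ≤ S := Finset.sum_nonneg fun e _ => add_nonneg (decay_pos _).le (decay_pos _).le
  have hA := hfA.nonneg
  have hB : ∀ e ∈ lineBonds (Finset.Ico (-m) m), e.1 ∈ Set.Icc (-m) m ∧ e.2 ∈ Set.Icc (-m) m := by
    intro e he
    rw [mem_lineBonds, Finset.mem_Ico] at he
    simp only [Set.mem_Icc]
    omega
  have hsub : lineBonds (Finset.Ico (-m) m) ⊆ lineBonds (Finset.Icc (-m - 1) m) := by
    intro e he
    rw [mem_lineBonds, Finset.mem_Ico] at he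
    rw [mem_lineBonds, Finset.mem_Icc]
    omega
  have hdep : ∀ s, 0 ≤ s → DependsOn (semigroup (p 1) (p (-1)) (lineBonds (Finset.Ico (-m) m)) s f)
      (Set.Icc (-m) m) := fun s hs => dependsOn_semigroup hB hf hs
  refine abs_dual_sub_exp_le (U := timeCorr P η hη.measurable g) (norm_timeCorr_le _ g)
    (bondGen (p 1) (p (-1)) (lineBonds (Finset.Ico (-m) m))) f ht (fun s hs hst => ?_)
    (fun s hs hst => ?_)
  · have h1 := hdep (t - s) (by linarith)
    exact ⟨(continuous_timeCorr hη hp hnn h1 g).continuousOn,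
      (continuous_timeCorr hη hp hnn (dependsOn_bondGen hB h1) g).continuousOn⟩
  · have hts : 0 ≤ t - s := by linarith
    refine ⟨_, hasDerivWithinAt_timeCorr hη hp hnn (hdep (t - s) hts) g hs, ?_⟩
    change |_ - timeCorr P η hη.measurable g s (bondGen (p 1) (p (-1))
      (lineBonds (Finset.Ico (-m) m)) (semigroup (p 1) (p (-1)) (lineBonds (Finset.Ico (-m) m))
        (t - s) f))| ≤ _
    rw [← map_sub]
    refine (ContinuousLinearMap.le_of_opNorm_le _ (norm_timeCorr_le _ g s) _).trans
      (mul_le_mul_of_nonneg_left ?_ (norm_nonneg _))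
    refine (norm_bondGen_sub_le (hp.nonneg _) (hp.nonneg _) (jump_add_eq_one hp hnn)
      (HasInfluence.semigroup (hp.nonneg _) (hp.nonneg _) (jump_add_eq_one hp hnn) hA hfA _ hts)
      hsub).trans ?_
    gcongr
    linarith

/-- Bonds outside of a long interval contribute little. -/
lemma sum_decay_sdiff_le {M m : ℕ} (x₀ : ℤ) (hm : |x₀| ≤ m) {s : Finset ℤ}
    (hs : s.card ≤ 2 * M + 2) :
    ∑ e ∈ lineBonds s \ lineBonds (Finset.Ico (-m : ℤ) m), (decay (e.1 - x₀) + decay (e.2 - x₀)) ≤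
      (4 * M + 4) * decay (m - |x₀|) := by
  have h1 : ∀ e ∈ lineBonds s \ lineBonds (Finset.Ico (-m : ℤ) m),
      decay (e.1 - x₀) + decay (e.2 - x₀) ≤ 2 * decay (m - |x₀|) := by
    intro e he
    rw [Finset.mem_sdiff, mem_lineBonds, mem_lineBonds, Finset.mem_Ico] at he
    have ha := abs_nonneg x₀
    have h3 : decay (e.1 - x₀) ≤ decay (m - |x₀|) := decay_anti (by grind)
    have h4 : decay (e.2 - x₀) ≤ decay (m - |x₀|) := decay_anti (by grind)
    linarith
  refine (Finset.sum_le_sum h1).trans ?_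
  rw [Finset.sum_const, nsmul_eq_mul]
  have h2 : ((lineBonds s \ lineBonds (Finset.Ico (-m : ℤ) m)).card : ℝ) ≤ 2 * M + 2 := by
    have : (lineBonds s \ lineBonds (Finset.Ico (-m : ℤ) m)).card ≤ 2 * M + 2 :=
      (Finset.card_le_card Finset.sdiff_subset).trans (by simpa [lineBonds] using hs)
    exact_mod_cast this
  have := decay_pos (m - |x₀|)
  nlinarith

lemma tendsto_mul_decay (c : ℤ) :
    Tendsto (fun m : ℕ => (4 * m + 4 : ℝ) * decay ((m : ℤ) - c)) atTop (𝓝 0) := by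
  have h1 : Tendsto (fun m : ℕ => (m : ℝ) * (1 / 2 : ℝ) ^ m) atTop (𝓝 0) :=
    tendsto_self_mul_const_pow_of_lt_one (by norm_num) (by norm_num)
  have h2 : Tendsto (fun m : ℕ => (1 / 2 : ℝ) ^ m) atTop (𝓝 0) :=
    tendsto_pow_atTop_nhds_zero_of_lt_one (by norm_num) (by norm_num)
  have h3 := ((h1.const_mul 4).add (h2.const_mul 4)).mul_const ((2 : ℝ) ^ c.natAbs)
  simp only [mul_zero, add_zero, zero_mul] at h3
  refine squeeze_zero (fun m => mul_nonneg (by positivity) (decay_pos _).le) (fun m => ?_) h3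
  have h4 : decay ((m : ℤ) - c) ≤ (1 / 2 : ℝ) ^ m * 2 ^ c.natAbs := by
    have h5 : m ≤ ((m : ℤ) - c).natAbs + c.natAbs := by omega
    have h6 : (1 / 2 : ℝ) ^ (((m : ℤ) - c).natAbs + c.natAbs) ≤ (1 / 2) ^ m :=
      pow_le_pow_of_le_one (by norm_num) (by norm_num) h5
    calc decay ((m : ℤ) - c) =
          (1 / 2 : ℝ) ^ (((m : ℤ) - c).natAbs + c.natAbs) * 2 ^ c.natAbs := by
          rw [pow_add, mul_assoc, ← mul_pow]; norm_num [decay]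
      _ ≤ _ := by gcongr
  calc _ ≤ (4 * m + 4 : ℝ) * ((1 / 2 : ℝ) ^ m * 2 ^ c.natAbs) := by gcongr
    _ = _ := by ring

lemma dependsOn_centered {A : Set ℤ} {x : ℤ} (hx : x ∈ A) : DependsOn (centered ρ x) A := by
  intro σ τ h
  simp only [centered_apply, occ, h x hx]

/-- The two-point function is the limit of the two-point functions of finite systems. -/
lemma tendsto_twoPoint (hη : IsStationaryExclusion P ℱ p ρ η) (hp : IsJumpLaw p)
    (hnn : ∀ z : ℤ, |z| ≠ 1 → p z = 0) (x : ℤ) (t : ℝ≥0) :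
    Tendsto (fun m : ℕ => pairing ρ (centered ρ 0)
      (semigroup (p 1) (p (-1)) (lineBonds (Finset.Ico (-m : ℤ) m)) t (centered ρ x))) atTop
      (𝓝 (twoPoint P ρ η x t)) := by
  have hη' := hη.toIsExclusionProcess
  -- Only the law at time 0 enters here; invariance of π_ρ under the process is not needed.
  have h0 : ∀ f : C(Config, ℝ), timeCorr P η hη'.measurable (centered ρ 0) 0 f =
      pairing ρ (centered ρ 0) f := by
    intro f
    rw [timeCorr_apply, pairing_apply, Real.toNNReal_zero, ← hη.initial_law]
    exact (integral_map (hη'.measurable 0).aemeasurable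
      (f * centered ρ 0).continuous.aestronglyMeasurable).symm
  have ht : timeCorr P η hη'.measurable (centered ρ 0) t (centered ρ x) =
      twoPoint P ρ η x t := by
    rw [timeCorr_apply, Real.toNNReal_coe]
    rfl
  rw [tendsto_iff_norm_sub_tendsto_zero]
  have hlim := ((tendsto_mul_decay |x|).const_mul
    ((t : ℝ) * (‖centered ρ 0‖ * (Real.exp (2 * t) * 1))))
  rw [mul_zero] at hlim
  refine squeeze_zero' (Eventually.of_forall fun m => norm_nonneg _) ?_ hlim
  filter_upwards [eventually_ge_atTop x.natAbs] with m hm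
  have hx : x ∈ Set.Icc (-m : ℤ) m := by rw [Set.mem_Icc]; omega
  have key := abs_timeCorr_sub_le hη' hp hnn (dependsOn_centered (ρ := ρ) hx)
    (hasInfluence_centered ρ x) (centered ρ 0) t.2
  rw [NNReal.val_eq_coe, h0, ht, abs_sub_comm] at key
  refine key.trans ?_
  have hc : (Finset.Icc (-m - 1 : ℤ) m).card ≤ 2 * m + 2 := by
    rw [Int.card_Icc]; omega
  have := sum_decay_sdiff_le (M := m) (m := m) x (by rw [Int.abs_eq_natAbs]; exact_mod_cast hm) hc
  calc _ ≤ (t : ℝ) * (‖centered ρ 0‖ * (Real.exp (2 * t) * 1 *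
        ((4 * m + 4) * decay (m - |x|)))) := by gcongr
    _ = _ := by ring

end Correlations

end ExclusionProcess

namespace ExclusionProcess

open Function (update)

/-! ### The exclusion process in a finite box -/

section FiniteSystem

variable (ρ : unitInterval) {P Q : ℝ}

/-- The sites of the finite system of size `m`. -/
noncomputable def box (m : ℕ) : Finset ℤ := Finset.Icc (-m : ℤ) m

/-- The bonds of the finite system of size `m`. -/
noncomputable def boxBonds (m : ℕ) : Finset (ℤ × ℤ) := lineBonds (Finset.Ico (-m : ℤ) m)

lemma mem_box {m : ℕ} {x : ℤ} : x ∈ box m ↔ -m ≤ x ∧ x ≤ m := Finset.mem_Icc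

lemma zero_mem_box (m : ℕ) : (0 : ℤ) ∈ box m := by rw [mem_box]; omega

lemma eventually_mem_box (x : ℤ) : ∀ᶠ m : ℕ in atTop, x ∈ box m := by
  filter_upwards [eventually_ge_atTop x.natAbs] with m hm
  rw [mem_box]; omega

lemma sum_Ico_eq_sum_box {M : Type*} [AddCommMonoid M] (m : ℕ) (h : ℤ → M) :
    ∑ y ∈ Finset.Ico (-m : ℤ) m, h y = ∑ x ∈ box m, if x < m then h x else 0 := by
  rw [← Finset.sum_filter]
  refine Finset.sum_congr ?_ fun _ _ => rfl
  ext x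
  simp only [Finset.mem_Ico, Finset.mem_filter, mem_box]
  omega

lemma sum_Ico_succ_eq_sum_box {M : Type*} [AddCommMonoid M] (m : ℕ) (h : ℤ → M) :
    ∑ y ∈ Finset.Ico (-m : ℤ) m, h (y + 1) = ∑ x ∈ box m, if -m < x then h x else 0 := by
  rw [← Finset.sum_filter]
  refine Finset.sum_bij (fun y _ => y + 1) ?_ ?_ ?_ fun _ _ => rfl
  · intro y hy
    simp only [Finset.mem_Ico, Finset.mem_filter, mem_box] at hy ⊢
    omega
  · intro a _ b _ h
    exact add_right_cancel h
  · intro y hy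
    simp only [Finset.mem_filter, mem_box] at hy
    exact ⟨y - 1, by rw [Finset.mem_Ico]; omega, by omega⟩

lemma sum_box_neg {M : Type*} [AddCommMonoid M] (m : ℕ) (h : ℤ → M) :
    ∑ x ∈ box m, h (-x) = ∑ x ∈ box m, h x :=
  Finset.sum_equiv (Equiv.neg ℤ) (fun x => by simp only [mem_box, Equiv.neg_apply]; omega)
    fun _ _ => rfl

/-! ### Conservation of particles -/

lemma sum_centered_move {m : ℕ} {u v : ℤ} (hu : u ∈ box m) (hv : v ∈ box m) (huv : u ≠ v)
    (σ : Config) :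
    (∑ x ∈ box m, centered ρ x) (move u v σ) = (∑ x ∈ box m, centered ρ x) σ := by
  simp only [ContinuousMap.sum_apply]
  rw [← sub_eq_zero, ← Finset.sum_sub_distrib,
    ← Finset.sum_subset (s₁ := {u, v}) (by simp [Finset.insert_subset_iff, hu, hv])
      fun x _ hx => ?_]
  · rw [Finset.sum_pair huv]
    simp only [centered_apply, occ, move_apply, huv.symm, if_true, if_false]
    cases σ u <;> cases σ v <;> simp <;> ring
  · simp only [Finset.mem_insert, Finset.mem_singleton, not_or] at hx
    simp [centered_apply, occ, move_apply, hx.1, hx.2]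

lemma mem_boxBonds {m : ℕ} {e : ℤ × ℤ} (he : e ∈ boxBonds m) :
    e.1 ∈ box m ∧ e.2 ∈ box m ∧ e.1 ≠ e.2 := by
  rw [boxBonds, mem_lineBonds, Finset.mem_Ico] at he
  rw [mem_box, mem_box]
  omega

lemma semigroup_sum_centered (hPQ : P + Q = 1) (m : ℕ) (t : ℝ) :
    semigroup P Q (boxBonds m) t (∑ x ∈ box m, centered ρ x) = ∑ x ∈ box m, centered ρ x :=
  semigroup_of_invariant hPQ (fun _ he σ =>
    ⟨sum_centered_move ρ (mem_boxBonds he).1 (mem_boxBonds he).2.1 (mem_boxBonds he).2.2 σ,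
      sum_centered_move ρ (mem_boxBonds he).2.1 (mem_boxBonds he).1 (mem_boxBonds he).2.2.symm σ⟩) t

/-! ### Correlations of the finite systems -/

/-- The two-point function of the finite system of size `m`. -/
noncomputable def boxTwoPoint (P Q : ℝ) (m : ℕ) (t : ℝ) (x : ℤ) : ℝ :=
  pairing ρ (centered ρ 0) (semigroup P Q (boxBonds m) t (centered ρ x))

/-- The correlation of the bond `(x, x + 1)` at time `t` with the origin at time `0`. -/
noncomputable def boxBondCorr (P Q : ℝ) (m : ℕ) (t : ℝ) (x : ℤ) : ℝ :=
  pairing ρ (centered ρ 0) (semigroup P Q (boxBonds m) t (centered ρ x * centered ρ (x + 1)))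

/-- The correlation of the site `x` at time `t` with the bond `(0, 1)` at time `0`. -/
noncomputable def boxBondCorr' (P Q : ℝ) (m : ℕ) (t : ℝ) (x : ℤ) : ℝ :=
  pairing ρ (centered ρ 0 * centered ρ 1) (semigroup P Q (boxBonds m) t (centered ρ x))

lemma abs_boxTwoPoint_le (hP : 0 ≤ P) (hQ : 0 ≤ Q) (hPQ : P + Q = 1) (m : ℕ) {t : ℝ} (ht : 0 ≤ t)
    (x : ℤ) : |boxTwoPoint ρ P Q m t x| ≤ Real.exp (2 * t) * decay x := by
  have := (HasInfluence.semigroup hP hQ hPQ zero_le_one (hasInfluence_centered ρ x)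
    (Finset.Ico (-m : ℤ) m) ht).abs_pairing_centered_le ρ 0
  rwa [mul_one, zero_sub, decay_neg] at this

lemma abs_boxBondCorr_le (hP : 0 ≤ P) (hQ : 0 ≤ Q) (hPQ : P + Q = 1) (m : ℕ) {t : ℝ} (ht : 0 ≤ t)
    (x : ℤ) : |boxBondCorr ρ P Q m t x| ≤ 2 * Real.exp (2 * t) * decay x := by
  have := (HasInfluence.semigroup hP hQ hPQ zero_le_two (hasInfluence_centered_mul ρ x)
    (Finset.Ico (-m : ℤ) m) ht).abs_pairing_centered_le ρ 0
  rwa [mul_comm _ (2 : ℝ), zero_sub, decay_neg] at this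

lemma abs_boxBondCorr'_le (hP : 0 ≤ P) (hQ : 0 ≤ Q) (hPQ : P + Q = 1) (m : ℕ) {t : ℝ}
    (ht : 0 ≤ t) (x : ℤ) : |boxBondCorr' ρ P Q m t x| ≤ Real.exp (2 * t) * decay x := by
  have := (HasInfluence.semigroup hP hQ hPQ zero_le_one (hasInfluence_centered ρ x)
    (Finset.Ico (-m : ℤ) m) ht).abs_pairing_centered_mul_le ρ (zero_ne_one (α := ℤ))
  rwa [mul_one, zero_sub, decay_neg] at this

lemma hasDerivAt_pairing_semigroup (B : Finset (ℤ × ℤ)) (f g : C(Config, ℝ)) (t : ℝ) :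
    HasDerivAt (fun s => pairing ρ g (semigroup P Q B s f))
      (pairing ρ g (semigroup P Q B t (bondGen P Q B f))) t :=
  (pairing ρ g).hasFDerivAt.comp_hasDerivAt t (hasDerivAt_exp_smul_apply (bondGen P Q B) f t)

lemma continuous_pairing_semigroup (B : Finset (ℤ × ℤ)) (f g : C(Config, ℝ)) :
    Continuous fun t => pairing ρ g (semigroup P Q B t f) :=
  continuous_iff_continuousAt.2 fun t => (hasDerivAt_pairing_semigroup ρ B f g t).continuousAt

lemma sum_boxTwoPoint (hPQ : P + Q = 1) (m : ℕ) (t : ℝ) :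
    ∑ x ∈ box m, boxTwoPoint ρ P Q m t x = ρ * (1 - ρ) := by
  simp only [boxTwoPoint, ← map_sum]
  rw [semigroup_sum_centered ρ hPQ, map_sum]
  simp [pairing_centered_centered, zero_mem_box]

lemma sum_boxBondCorr' (hPQ : P + Q = 1) (m : ℕ) (t : ℝ) :
    ∑ x ∈ box m, boxBondCorr' ρ P Q m t x = 0 := by
  simp only [boxBondCorr', ← map_sum]
  rw [semigroup_sum_centered ρ hPQ, map_sum]
  simp [pairing_centered_mul_centered_centered]

/-- The function is linear, so its mixed differences vanish, and a particle that moves to the right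
gains weight. The restriction to the box matters because sites outside it carry weight 0. -/
lemma isDriftModular_sum (b : ℝ) (m : ℕ) :
    IsDriftModular (box m : Set ℤ) b (∑ y ∈ box m, (y : ℝ) • centered ρ y) := by
  have hval : ∀ x ∈ box m, ∀ y ∈ box m, x < y → ∀ σ a c,
      (∑ z ∈ box m, (z : ℝ) • centered ρ z) (update (update σ x a) y c) =
        (∑ z ∈ (box m).erase x |>.erase y, (z : ℝ) * (occ σ z - ρ)) +
          y * ((if c then 1 else 0) - ρ) + x * ((if a then 1 else 0) - ρ) := by
    intro x hx y hy hxy σ a c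
    have hy' : y ∈ (box m).erase x := Finset.mem_erase.2 ⟨hxy.ne', hy⟩
    rw [ContinuousMap.sum_apply, ← Finset.sum_erase_add _ _ hx, ← Finset.sum_erase_add _ _ hy']
    congr 1
    · congr 1
      · refine Finset.sum_congr rfl fun z hz => ?_
        simp only [Finset.mem_erase] at hz
        simp [centered_apply, occ_update, hz.1, hz.2.1]
      · simp [centered_apply, occ_update]
    · simp [centered_apply, occ_update, hxy.ne]
  constructor
  · intro x y σ hx hy hxy
    rw [hval x hx y hy hxy, hval x hx y hy hxy]
    have : (x : ℝ) ≤ y := by exact_mod_cast hxy.le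
    simp
    linarith
  · intro x y σ hx hy hxy
    rw [hval x hx y hy hxy, hval x hx y hy hxy, hval x hx y hy hxy, hval x hx y hy hxy]
    apply le_of_eq
    simp
    ring_nf
    simp

/-- The drift of two interacting second-class particles has a sign. -/
lemma sum_mul_boxBondCorr'_nonneg (hP : 0 ≤ P) (hQ : 0 ≤ Q) (hPQ : P + Q = 1) {m : ℕ}
    (hm : 1 ≤ m) {t : ℝ} (ht : 0 ≤ t) :
    0 ≤ (P - Q) * ∑ x ∈ box m, x * boxBondCorr' ρ Q P m t x := by
  set H : C(Config, ℝ) := ∑ y ∈ box m, (y : ℝ) • centered ρ y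
  have e : ∑ x ∈ box m, x * boxBondCorr' ρ Q P m t x =
      pairing ρ (centered ρ 0 * centered ρ 1) (semigroup Q P (boxBonds m) t H) := by
    simp only [H, map_sum, map_smul, smul_eq_mul]
    rfl
  rw [e, pairing_centered_mul_centered ρ zero_ne_one, mul_left_comm, ← integral_const_mul]
  refine mul_nonneg (sq_nonneg _) (integral_nonneg fun σ => ?_)
  -- The dynamics has the exchanged rates, so the parameter b of the cone is P - Q.
  refine IsDriftModular.semigroup_modular (A := (box m : Set ℤ)) hQ hP (by linarith) rfl
    (isDriftModular_sum ρ _ m) (fun w hw => ?_) ht σ ?_ ?_ one_pos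
  · rw [Finset.mem_Ico] at hw
    simp only [Finset.mem_coe, mem_box]
    omega
  · exact zero_mem_box m
  · simp only [Finset.mem_coe, mem_box]
    omega

/-! ### The generator on linear functions -/

/-- This is the continuity equation on one bond: the bracket is the current from `y` to `y + 1`,
expanded in centered variables. -/
lemma resample_centered (hPQ : P + Q = 1) (y x : ℤ) :
    resample P Q (y, y + 1) (centered ρ x) - centered ρ x =
      ((if x = y + 1 then 1 else 0) - (if x = y then 1 else 0) : ℝ) •
        ((P - (P - Q) * ρ) • centered ρ y - (Q + (P - Q) * ρ) • centered ρ (y + 1) -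
          (P - Q) • (centered ρ y * centered ρ (y + 1)) +
          ContinuousMap.const Config ((P - Q) * (ρ * (1 - ρ)))) := by
  have hQ : Q = 1 - P := by linarith
  subst hQ
  ext σ
  have hne : y + 1 ≠ y := by omega
  simp only [ContinuousMap.sub_apply, resample_apply, ContinuousMap.smul_apply,
    ContinuousMap.add_apply, ContinuousMap.mul_apply, ContinuousMap.const_apply, smul_eq_mul,
    centered_apply]
  by_cases h1 : x = y
  · subst h1
    simp only [occ, move_apply, hne.symm, if_true, if_false]
    cases σ x <;> cases σ (x + 1) <;> simp <;> ring
  by_cases h2 : x = y + 1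
  · subst h2
    simp only [occ, move_apply, hne, if_true, if_false]
    cases σ y <;> cases σ (y + 1) <;> simp <;> ring
  · simp only [occ, move_apply, h1, h2, if_false]
    ring

/-- Each bond carries its current from `y` to `y + 1` and so changes the weighted sum by the
increment of `c`. No current leaves the box. -/
lemma bondGen_sum_centered (hPQ : P + Q = 1) (m : ℕ) (c : ℤ → ℝ) :
    bondGen P Q (boxBonds m) (∑ x ∈ box m, c x • centered ρ x) =
      ∑ y ∈ Finset.Ico (-m : ℤ) m, (c (y + 1) - c y) •
        ((P - (P - Q) * ρ) • centered ρ y - (Q + (P - Q) * ρ) • centered ρ (y + 1) -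
          (P - Q) • (centered ρ y * centered ρ (y + 1)) +
          ContinuousMap.const Config ((P - Q) * (ρ * (1 - ρ)))) := by
  have h1 : ∀ f, bondGen P Q (boxBonds m) f =
      ∑ y ∈ Finset.Ico (-m : ℤ) m, (resample P Q (y, y + 1) f - f) := by
    intro f
    ext σ
    rw [bondGen_apply, boxBonds, sum_lineBonds, ContinuousMap.sum_apply]
    rfl
  rw [h1]
  refine Finset.sum_congr rfl fun y hy => ?_
  rw [Finset.mem_Ico] at hy
  have hy1 : y ∈ box m := by rw [mem_box]; omega
  have hy2 : y + 1 ∈ box m := by rw [mem_box]; omega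
  simp only [map_sum, map_smul]
  rw [← Finset.sum_sub_distrib]
  simp only [← smul_sub, resample_centered ρ hPQ, smul_smul]
  rw [← Finset.sum_smul]
  congr 1
  simp [mul_sub, Finset.sum_sub_distrib, hy1, hy2]

/-- The difference of the time derivative of the second moment of the finite system and of its
value for the infinite system, at the site `x`. -/
noncomputable def boxError (P Q : ℝ) (m : ℕ) (t : ℝ) (x : ℤ) : ℝ :=
  ((if x < m then (2 * (x : ℝ) + 1 - 2 * ((1 - 2 * (ρ : ℝ)) * (P - Q) * t)) *
        (P - (P - Q) * (ρ : ℝ)) else 0) -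
      (if -m < x then (2 * (x : ℝ) - 1 - 2 * ((1 - 2 * (ρ : ℝ)) * (P - Q) * t)) *
        (Q + (P - Q) * (ρ : ℝ)) else 0) -
      2 * ((1 - 2 * (ρ : ℝ)) * (P - Q)) * ((x : ℝ) - (1 - 2 * (ρ : ℝ)) * (P - Q) * t) - 1) *
    boxTwoPoint ρ P Q m t x -
  (P - Q) * (2 * (x : ℝ) + 1 - 2 * ((1 - 2 * (ρ : ℝ)) * (P - Q) * t)) *
    ((if x < m then boxBondCorr ρ P Q m t x else 0) - boxBondCorr' ρ Q P m t (-x))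

/-- The square has increment 2y + 1 - 2vt over a bond, which multiplies the current. The term χ is
the total mass of the two-point function; the bond correlations are replaced by their duals, and all
that remains is put into `boxError`. -/
lemma hasDerivAt_sum_boxTwoPoint (hPQ : P + Q = 1) (m : ℕ) (t : ℝ) :
    HasDerivAt (fun s => ∑ x ∈ box m, ((x : ℝ) - (1 - 2 * ρ) * (P - Q) * s) ^ 2 *
        boxTwoPoint ρ P Q m s x)
      (ρ * (1 - ρ) + 2 * ((P - Q) * ∑ x ∈ box m, x * boxBondCorr' ρ Q P m t x) +
        ∑ x ∈ box m, boxError ρ P Q m t x) t := by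
  set b := P - Q with hb
  set v := (1 - 2 * (ρ : ℝ)) * b with hv
  set J : ℤ → C(Config, ℝ) := fun y =>
    (P - b * ρ) • centered ρ y - (Q + b * ρ) • centered ρ (y + 1) -
      b • (centered ρ y * centered ρ (y + 1)) +
      ContinuousMap.const Config (b * (ρ * (1 - ρ))) with hJ
  have hJp : ∀ y, pairing ρ (centered ρ 0) (semigroup P Q (boxBonds m) t (J y)) =
      (P - b * ρ) * boxTwoPoint ρ P Q m t y - (Q + b * ρ) * boxTwoPoint ρ P Q m t (y + 1) -
        b * boxBondCorr ρ P Q m t y := by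
    intro y
    simp only [hJ, map_sub, map_add, map_smul, smul_eq_mul]
    rw [semigroup_of_invariant hPQ (f := ContinuousMap.const Config _)
      (fun _ _ _ => ⟨rfl, rfl⟩), pairing_centered_const, add_zero]
    rfl
  have h1 : HasDerivAt (fun s => ∑ x ∈ box m, ((x : ℝ) - v * s) ^ 2 * boxTwoPoint ρ P Q m s x)
      (∑ x ∈ box m, (2 * ((x : ℝ) - v * t) * (-v) * boxTwoPoint ρ P Q m t x +
        ((x : ℝ) - v * t) ^ 2 * pairing ρ (centered ρ 0) (semigroup P Q (boxBonds m) t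
          (bondGen P Q (boxBonds m) (centered ρ x))))) t := by
    refine HasDerivAt.fun_sum fun x _ => ?_
    refine HasDerivAt.fun_mul ?_ (hasDerivAt_pairing_semigroup ρ _ _ _ t)
    have h2 : HasDerivAt (fun s : ℝ => (x : ℝ) - v * s) (-v) t := by
      simpa using ((hasDerivAt_id t).const_mul v).const_sub (x : ℝ)
    simpa using h2.fun_pow 2
  convert h1 using 1
  have h2 : ∑ x ∈ box m, ((x : ℝ) - v * t) ^ 2 * pairing ρ (centered ρ 0)
      (semigroup P Q (boxBonds m) t (bondGen P Q (boxBonds m) (centered ρ x))) =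
      ∑ y ∈ Finset.Ico (-m : ℤ) m, (2 * y + 1 - 2 * (v * t)) *
        ((P - b * ρ) * boxTwoPoint ρ P Q m t y - (Q + b * ρ) * boxTwoPoint ρ P Q m t (y + 1) -
          b * boxBondCorr ρ P Q m t y) := by
    have h3 := bondGen_sum_centered ρ hPQ m fun x => ((x : ℝ) - v * t) ^ 2
    have h4 := congrArg (fun f => pairing ρ (centered ρ 0) (semigroup P Q (boxBonds m) t f)) h3
    simp only [map_sum, map_smul, smul_eq_mul] at h4
    rw [h4]
    refine Finset.sum_congr rfl fun y _ => ?_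
    change _ * pairing ρ (centered ρ 0) (semigroup P Q (boxBonds m) t (J y)) = _
    rw [hJp]
    congr 1
    push_cast
    ring
  have h3 : ∑ y ∈ Finset.Ico (-m : ℤ) m, (2 * y + 1 - 2 * (v * t)) *
        ((P - b * ρ) * boxTwoPoint ρ P Q m t y - (Q + b * ρ) * boxTwoPoint ρ P Q m t (y + 1) -
          b * boxBondCorr ρ P Q m t y) =
      ∑ x ∈ box m, (
        ((if x < m then (2 * x + 1 - 2 * (v * t)) * (P - b * ρ) else 0) -
          (if -m < x then (2 * x - 1 - 2 * (v * t)) * (Q + b * ρ) else 0)) *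
            boxTwoPoint ρ P Q m t x -
        b * (2 * x + 1 - 2 * (v * t)) * (if x < m then boxBondCorr ρ P Q m t x else 0)) := by
    have k1 := sum_Ico_eq_sum_box m fun x => (2 * x + 1 - 2 * (v * t)) *
      ((P - b * ρ) * boxTwoPoint ρ P Q m t x - b * boxBondCorr ρ P Q m t x)
    have k2 := sum_Ico_succ_eq_sum_box m fun x => (2 * x - 1 - 2 * (v * t)) *
      ((Q + b * ρ) * boxTwoPoint ρ P Q m t x)
    calc _ = ∑ y ∈ Finset.Ico (-m : ℤ) m, ((2 * y + 1 - 2 * (v * t)) *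
          ((P - b * ρ) * boxTwoPoint ρ P Q m t y - b * boxBondCorr ρ P Q m t y) -
          (2 * ((y + 1 : ℤ) : ℝ) - 1 - 2 * (v * t)) *
            ((Q + b * ρ) * boxTwoPoint ρ P Q m t (y + 1))) := by
          refine Finset.sum_congr rfl fun y _ => ?_
          push_cast
          ring
      _ = _ := by
          rw [Finset.sum_sub_distrib, k1, k2, ← Finset.sum_sub_distrib]
          refine Finset.sum_congr rfl fun x _ => ?_
          split_ifs <;> ring
  -- Under the reflection x ↦ -x, only the term linear in `x` survives, since the dual correlations
  -- sum to 0.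
  have h4 : ∑ x ∈ box m, b * (2 * (x : ℝ) + 1 - 2 * (v * t)) * boxBondCorr' ρ Q P m t (-x) =
      -(2 * (b * ∑ x ∈ box m, x * boxBondCorr' ρ Q P m t x)) := by
    rw [← sum_box_neg]
    have k := sum_boxBondCorr' ρ (P := Q) (Q := P) (by linarith) m t
    have k1 : ∑ x ∈ box m, b * (2 * ((-x : ℤ) : ℝ) + 1 - 2 * (v * t)) *
        boxBondCorr' ρ Q P m t (- -x) = ∑ x ∈ box m, (-(2 * (b * (x * boxBondCorr' ρ Q P m t x))) +
          b * (1 - 2 * (v * t)) * boxBondCorr' ρ Q P m t x) := by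
      refine Finset.sum_congr rfl fun x _ => ?_
      rw [neg_neg]
      push_cast
      ring
    rw [k1, Finset.sum_add_distrib, ← Finset.mul_sum, k, mul_zero, add_zero,
      Finset.sum_neg_distrib, Finset.mul_sum, Finset.mul_sum]
  have h5 := sum_boxTwoPoint ρ hPQ m t
  rw [Finset.sum_add_distrib, h2, h3, ← Finset.sum_add_distrib, ← h5,
    ← neg_neg (2 * (b * ∑ x ∈ box m, x * boxBondCorr' ρ Q P m t x)), ← h4,
    ← Finset.sum_neg_distrib, ← Finset.sum_add_distrib, ← Finset.sum_add_distrib]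
  refine Finset.sum_congr rfl fun x _ => ?_
  rw [boxError, ← hb, ← hv]
  ring

/-! ### Duality of the finite systems in the limit -/

lemma tendsto_pairing_semigroup_sub (hP : 0 ≤ P) (hQ : 0 ≤ Q) (hPQ : P + Q = 1)
    {f : C(Config, ℝ)} {A : ℝ} {x₀ : ℤ} (hf : HasInfluence f A x₀) (g : C(Config, ℝ))
    {t : ℝ} (ht : 0 ≤ t) (k : ℕ → ℕ) (B : ℕ → Finset (ℤ × ℤ)) (c : ℤ)
    (hB : ∀ᶠ m in atTop, boxBonds (k m) ⊆ B m ∧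
      ∑ e ∈ B m \ boxBonds (k m), (decay (e.1 - x₀) + decay (e.2 - x₀)) ≤
        (4 * m + 4) * decay (m - c)) :
    Tendsto (fun m => pairing ρ g (semigroup P Q (B m) t f) -
      pairing ρ g (semigroup P Q (boxBonds (k m)) t f)) atTop (𝓝 0) := by
  have hlim := (tendsto_mul_decay c).const_mul (t * (‖g‖ * (Real.exp (2 * t) * A)))
  rw [mul_zero] at hlim
  refine squeeze_zero_norm' ?_ hlim
  filter_upwards [hB] with m hm
  have hA := hf.nonneg
  calc _ ≤ t * (‖g‖ * (Real.exp (2 * t) * A *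
        ∑ e ∈ B m \ boxBonds (k m), (decay (e.1 - x₀) + decay (e.2 - x₀)))) :=
        abs_pairing_semigroup_sub_le ρ hP hQ hPQ hf hm.1 g ht
    _ ≤ t * (‖g‖ * (Real.exp (2 * t) * A * ((4 * m + 4) * decay (m - c)))) := by
        gcongr
        exact hm.2
    _ = _ := by ring

/-- The bonds of a ring of length `2 * m + 1`. -/
noncomputable def ringBonds (m : ℕ) : Finset (ℤ × ℤ) := insert ((m : ℤ), (-m : ℤ)) (boxBonds m)

lemma ring_notMem (m : ℕ) : ((m : ℤ), (-m : ℤ)) ∉ boxBonds m := by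
  rw [boxBonds, mem_lineBonds, Finset.mem_Ico]
  simp

lemma ringBonds_compare (x₀ : ℤ) : ∀ᶠ m : ℕ in atTop, boxBonds m ⊆ ringBonds m ∧
    ∑ e ∈ ringBonds m \ boxBonds m, (decay (e.1 - x₀) + decay (e.2 - x₀)) ≤
      (4 * m + 4) * decay (m - |x₀|) := by
  filter_upwards [eventually_ge_atTop x₀.natAbs] with m hm
  refine ⟨Finset.subset_insert _ _, ?_⟩
  have h1 : ringBonds m \ boxBonds m = {((m : ℤ), (-m : ℤ))} := by
    rw [ringBonds, Finset.insert_sdiff_of_notMem _ (ring_notMem m), sdiff_self]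
    rfl
  rw [h1, Finset.sum_singleton]
  have h3 : decay (m - x₀) ≤ decay (m - |x₀|) := decay_anti (by grind)
  have h4 : decay (-m - x₀) ≤ decay (m - |x₀|) := decay_anti (by grind)
  have := decay_pos (m - |x₀|)
  nlinarith [(Nat.cast_nonneg m : (0 : ℝ) ≤ m)]

/-- The gradients telescope around the ring, which is the condition for exact duality. -/
lemma sum_ringBonds (m : ℕ) :
    ∑ e ∈ ringBonds m, (centered ρ e.2 - centered ρ e.1) = 0 := by
  rw [ringBonds, Finset.sum_insert (ring_notMem m), boxBonds, sum_lineBonds,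
    Finset.sum_sub_distrib, sum_Ico_succ_eq_sum_box, sum_Ico_eq_sum_box,
    ← Finset.sum_sub_distrib]
  have : ∀ x ∈ box m, ((if -m < x then centered ρ x else 0) - if x < m then centered ρ x else 0) =
      (if x = (m : ℤ) then centered ρ x else 0) - if x = (-m : ℤ) then centered ρ x else 0 := by
    intro x hx
    rw [mem_box] at hx
    split_ifs <;> first | omega | simp
  rw [Finset.sum_congr rfl this, Finset.sum_sub_distrib, Finset.sum_ite_eq', Finset.sum_ite_eq',
    if_pos (by rw [mem_box]; omega), if_pos (by rw [mem_box]; omega)]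
  abel

/-- The box is replaced by the ring, where time reversal is exact, and then the ring by the box for
the exchanged rates. Translation by `-x` moves the bond to (0, 1) but shifts the box, so the shifted
and the original box are both compared with a smaller box contained in each. -/
lemma tendsto_boxBondCorr_sub (hP : 0 ≤ P) (hQ : 0 ≤ Q) (hPQ : P + Q = 1) {t : ℝ} (ht : 0 ≤ t)
    (x : ℤ) : Tendsto (fun m => boxBondCorr ρ P Q m t x - boxBondCorr' ρ Q P m t (-x)) atTop
      (𝓝 0) := by
  have hQP : Q + P = 1 := by linarith
  have l1 := tendsto_pairing_semigroup_sub ρ hP hQ hPQ (hasInfluence_centered_mul ρ x)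
    (centered ρ 0) ht id ringBonds |x| (ringBonds_compare x)
  have l2 := tendsto_pairing_semigroup_sub ρ hQ hP hQP (hasInfluence_centered ρ 0)
    (centered ρ x * centered ρ (x + 1)) ht id ringBonds |0| (ringBonds_compare 0)
  -- The small box has radius m - |x| and the observable sits at -x, which leaves the distance m -
  -- 2|x| to the additional bonds.
  have hcmp : ∀ (s : ℕ → Finset ℤ), (∀ m : ℕ, (s m).card ≤ 2 * m + 2) →
      (∀ m : ℕ, Finset.Ico (-(m - x.natAbs : ℕ) : ℤ) (m - x.natAbs : ℕ) ⊆ s m) →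
      ∀ᶠ m : ℕ in atTop, boxBonds (m - x.natAbs) ⊆ lineBonds (s m) ∧
        ∑ e ∈ lineBonds (s m) \ boxBonds (m - x.natAbs), (decay (e.1 - -x) + decay (e.2 - -x)) ≤
          (4 * m + 4) * decay (m - 2 * |x|) := by
    intro s hcard hsub
    filter_upwards [eventually_ge_atTop (2 * x.natAbs)] with m hm
    refine ⟨Finset.map_subset_map.2 (hsub m), ?_⟩
    have h1 := sum_decay_sdiff_le (M := m) (m := m - x.natAbs) (-x)
      (by rw [abs_neg, Int.abs_eq_natAbs]; omega) (hcard m)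
    have h2 : ((m - x.natAbs : ℕ) : ℤ) - |-x| = m - 2 * |x| := by
      rw [abs_neg, Int.abs_eq_natAbs]; omega
    rwa [h2] at h1
  have l3 := tendsto_pairing_semigroup_sub ρ hQ hP hQP (hasInfluence_centered ρ (-x))
    (centered ρ 0 * centered ρ 1) ht (fun m => m - x.natAbs)
    (fun m => lineBonds ((Finset.Ico (-m : ℤ) m).map (Equiv.addRight (-x)).toEmbedding)) (2 * |x|)
    (hcmp _ (fun m => by rw [Finset.card_map, Int.card_Ico]; omega) fun m y hy => by
      rw [Finset.mem_Ico] at hy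
      rw [Finset.mem_map_equiv, Finset.mem_Ico, Equiv.addRight_symm, Equiv.coe_addRight]
      dsimp only
      omega)
  have l4 := tendsto_pairing_semigroup_sub ρ hQ hP hQP (hasInfluence_centered ρ (-x))
    (centered ρ 0 * centered ρ 1) ht (fun m => m - x.natAbs) boxBonds (2 * |x|)
    (hcmp _ (fun m => by rw [Int.card_Ico]; omega) fun m y hy => by
      rw [Finset.mem_Ico] at hy ⊢
      omega)
  have l5 := ((l2.sub l1).add (l3.sub l4))
  simp only [sub_self, add_zero] at l5
  refine l5.congr' ?_
  filter_upwards [eventually_ge_atTop 1] with m hm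
  have e1 : pairing ρ (centered ρ 0)
      (semigroup P Q (ringBonds m) t (centered ρ x * centered ρ (x + 1))) =
      pairing ρ (centered ρ x * centered ρ (x + 1))
        (semigroup Q P (ringBonds m) t (centered ρ 0)) := by
    refine pairing_semigroup_comm ρ hPQ (fun e he => ?_) (sum_ringBonds ρ m) _ _ t
    rw [ringBonds, Finset.mem_insert] at he
    rcases he with rfl | he
    · simp only
      omega
    · exact (mem_boxBonds he).2.2
  have e2 : pairing ρ (centered ρ x * centered ρ (x + 1))
      (semigroup Q P (boxBonds m) t (centered ρ 0)) =
      pairing ρ (centered ρ 0 * centered ρ 1) (semigroup Q P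
        (lineBonds ((Finset.Ico (-m : ℤ) m).map (Equiv.addRight (-x)).toEmbedding)) t
        (centered ρ (-x))) := by
    rw [← pairing_shift ρ (-x), boxBonds, compOp_shift_semigroup, compOp_shift_centered, zero_add]
    congr 2
    change compOp (shift (-x)) (centered ρ x) * compOp (shift (-x)) (centered ρ (x + 1)) = _
    rw [compOp_shift_centered, compOp_shift_centered, add_neg_cancel, add_right_comm,
      add_neg_cancel, zero_add]
  simp only [id]
  rw [e1, e2]
  simp only [boxBondCorr, boxBondCorr']
  ring

end FiniteSystem

end ExclusionProcess

namespace ExclusionProcess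

/-! ### Vanishing of the boundary and duality errors -/

section Limit

variable (ρ : unitInterval) {P Q : ℝ}

lemma summable_sq_mul_decay : Summable fun x : ℤ => (1 + |(x : ℝ)|) ^ 2 * decay x := by
  have h : Summable fun n : ℕ => (1 + (n : ℝ)) ^ 2 * (1 / 2 : ℝ) ^ n := by
    have h0 := summable_pow_mul_geometric_of_norm_lt_one (R := ℝ) 0 (r := 1 / 2) (by norm_num)
    have h1 := summable_pow_mul_geometric_of_norm_lt_one (R := ℝ) 1 (r := 1 / 2) (by norm_num)
    have h2 := summable_pow_mul_geometric_of_norm_lt_one (R := ℝ) 2 (r := 1 / 2) (by norm_num)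
    refine ((h0.add (h1.mul_left 2)).add h2).congr fun n => ?_
    ring
  refine Summable.of_nat_of_neg (h.congr fun n => ?_) (h.congr fun n => ?_) <;> simp [decay]

/-- The bound is uniform in `m` and in t ≤ T, so that it serves dominated convergence over the sites
and over time. The constant is 6 from the two-point term plus 2 · 3 from the bond correlations. -/
lemma abs_boxError_le (hP : 0 ≤ P) (hQ : 0 ≤ Q) (hPQ : P + Q = 1) (m : ℕ) {t T : ℝ} (ht : 0 ≤ t)
    (htT : t ≤ T) (x : ℤ) :
    |boxError ρ P Q m t x| ≤ 12 * Real.exp (2 * T) * (1 + T) * ((1 + |(x : ℝ)|) ^ 2 * decay x) := by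
  have hr0 := ρ.2.1
  have hr1 := ρ.2.2
  have hX := abs_nonneg (x : ℝ)
  have hd := decay_pos x
  set X := |(x : ℝ)|
  set d := decay x
  set E := Real.exp (2 * T)
  have hE : 0 < E := Real.exp_pos _
  have hT : 0 ≤ T := ht.trans htT
  have hEt : Real.exp (2 * t) ≤ E := Real.exp_le_exp.2 (by linarith)
  have ha : |boxTwoPoint ρ P Q m t x| ≤ E * d :=
    (abs_boxTwoPoint_le ρ hP hQ hPQ m ht x).trans (by gcongr)
  have hc : |boxBondCorr ρ P Q m t x| ≤ 2 * E * d :=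
    (abs_boxBondCorr_le ρ hP hQ hPQ m ht x).trans (by gcongr)
  have hc' : |boxBondCorr' ρ Q P m t (-x)| ≤ E * d := by
    have := abs_boxBondCorr'_le ρ hQ hP (by linarith) m ht (-x)
    rw [decay_neg] at this
    exact this.trans (by gcongr)
  have hα0 : 0 ≤ P - (P - Q) * (ρ : ℝ) := by nlinarith
  have hα1 : P - (P - Q) * (ρ : ℝ) ≤ 1 := by nlinarith
  have hβ0 : 0 ≤ Q + (P - Q) * (ρ : ℝ) := by nlinarith
  have hβ1 : Q + (P - Q) * (ρ : ℝ) ≤ 1 := by nlinarith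
  have hb : |P - Q| ≤ 1 := abs_le.2 ⟨by linarith, by linarith⟩
  have hv : |(1 - 2 * (ρ : ℝ)) * (P - Q)| ≤ 1 := by
    rw [abs_mul]
    exact mul_le_one₀ (abs_le.2 ⟨by linarith, by linarith⟩) (abs_nonneg _) hb
  unfold boxError
  set α := P - (P - Q) * (ρ : ℝ)
  set β := Q + (P - Q) * (ρ : ℝ)
  set v := (1 - 2 * (ρ : ℝ)) * (P - Q)
  have hvt : |v * t| ≤ T := by
    rw [abs_mul, abs_of_nonneg ht]
    calc |v| * t ≤ 1 * T := by gcongr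
      _ = T := one_mul T
  have hvt' := abs_le.1 hvt
  have hx := abs_le.1 (le_refl X)
  have k1 : |2 * (x : ℝ) + 1 - 2 * (v * t)| ≤ 2 * X + 1 + 2 * T :=
    abs_le.2 ⟨by linarith, by linarith⟩
  have k2 : |2 * (x : ℝ) - 1 - 2 * (v * t)| ≤ 2 * X + 1 + 2 * T :=
    abs_le.2 ⟨by linarith, by linarith⟩
  have k3 : |2 * v * ((x : ℝ) - v * t)| ≤ 2 * X + 2 * T := by
    have : |(x : ℝ) - v * t| ≤ X + T := abs_le.2 ⟨by linarith, by linarith⟩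
    rw [abs_mul, abs_mul, abs_two]
    calc 2 * |v| * |(x : ℝ) - v * t| ≤ 2 * 1 * (X + T) := by gcongr
      _ = _ := by ring
  have k4 : |if x < m then (2 * (x : ℝ) + 1 - 2 * (v * t)) * α else 0| ≤ 2 * X + 1 + 2 * T := by
    split_ifs
    · rw [abs_mul, abs_of_nonneg hα0]
      calc _ ≤ (2 * X + 1 + 2 * T) * 1 := by gcongr
        _ = _ := mul_one _
    · rw [abs_zero]; positivity
  have k5 : |if -m < x then (2 * (x : ℝ) - 1 - 2 * (v * t)) * β else 0| ≤ 2 * X + 1 + 2 * T := by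
    split_ifs
    · rw [abs_mul, abs_of_nonneg hβ0]
      calc _ ≤ (2 * X + 1 + 2 * T) * 1 := by gcongr
        _ = _ := mul_one _
    · rw [abs_zero]; positivity
  have k6 : |if x < m then boxBondCorr ρ P Q m t x else 0| ≤ 2 * E * d := by
    split_ifs
    · exact hc
    · rw [abs_zero]; positivity
  set A := if x < m then (2 * (x : ℝ) + 1 - 2 * (v * t)) * α else 0
  set B := if -m < x then (2 * (x : ℝ) - 1 - 2 * (v * t)) * β else 0
  set C := if x < m then boxBondCorr ρ P Q m t x else 0
  have k7 : |A - B - 2 * v * ((x : ℝ) - v * t) - 1| ≤ 6 * (1 + X) * (1 + T) := by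
    have := abs_le.1 k3
    have := abs_le.1 k4
    have := abs_le.1 k5
    have := mul_nonneg hX hT
    exact abs_le.2 ⟨by linarith, by linarith⟩
  have k8 : |C - boxBondCorr' ρ Q P m t (-x)| ≤ 3 * E * d := by
    have := abs_le.1 k6
    have := abs_le.1 hc'
    exact abs_le.2 ⟨by linarith, by linarith⟩
  have k9 : |(P - Q) * (2 * (x : ℝ) + 1 - 2 * (v * t))| ≤ 2 * (1 + X) * (1 + T) := by
    rw [abs_mul]
    have := mul_nonneg hX hT
    calc _ ≤ 1 * (2 * X + 1 + 2 * T) := by gcongr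
      _ ≤ _ := by linarith
  calc _ ≤ |(A - B - 2 * v * ((x : ℝ) - v * t) - 1) * boxTwoPoint ρ P Q m t x| +
        |(P - Q) * (2 * (x : ℝ) + 1 - 2 * (v * t)) * (C - boxBondCorr' ρ Q P m t (-x))| :=
        abs_sub _ _
    _ ≤ 6 * (1 + X) * (1 + T) * (E * d) + 2 * (1 + X) * (1 + T) * (3 * E * d) := by
        rw [abs_mul, abs_mul _ (C - boxBondCorr' ρ Q P m t (-x))]
        gcongr
    _ = 12 * E * (1 + T) * ((1 + X) * 1 * d) := by ring
    _ ≤ 12 * E * (1 + T) * ((1 + X) ^ 2 * d) := by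
        rw [sq]
        gcongr
        linarith

/-- Away from the boundary the coefficient of the two-point function vanishes identically, because
(P - bρ) - (Q + bρ) = v and (P - bρ) + (Q + bρ) = 1. Only the duality defect remains. -/
lemma tendsto_boxError (hP : 0 ≤ P) (hQ : 0 ≤ Q) (hPQ : P + Q = 1) {t : ℝ} (ht : 0 ≤ t) (x : ℤ) :
    Tendsto (fun m => boxError ρ P Q m t x) atTop (𝓝 0) := by
  have h1 := (tendsto_boxBondCorr_sub ρ hP hQ hPQ ht x).const_mul
    (-((P - Q) * (2 * (x : ℝ) + 1 - 2 * ((1 - 2 * (ρ : ℝ)) * (P - Q) * t))))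
  rw [mul_zero] at h1
  refine h1.congr' ?_
  filter_upwards [eventually_gt_atTop x.natAbs] with m hm
  have hQ' : Q = 1 - P := by linarith
  rw [boxError, if_pos (by omega), if_pos (by omega), if_pos (by omega)]
  subst hQ'
  ring

lemma tendsto_sum_box {f : ℕ → ℤ → ℝ} {g bound : ℤ → ℝ} (hs : Summable bound)
    (hb : ∀ m x, |f m x| ≤ bound x) (hf : ∀ x, Tendsto (fun m => f m x) atTop (𝓝 (g x))) :
    Tendsto (fun m => ∑ x ∈ box m, f m x) atTop (𝓝 (∑' x, g x)) := by
  have h1 : ∀ m, ∑ x ∈ box m, f m x = ∑' x, if x ∈ box m then f m x else 0 := by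
    intro m
    rw [tsum_eq_sum (s := box m) fun x hx => if_neg hx]
    exact Finset.sum_congr rfl fun x hx => (if_pos hx).symm
  simp only [h1]
  refine tendsto_tsum_of_dominated_convergence hs (fun x => ?_)
    (Eventually.of_forall fun m x => ?_)
  · refine (hf x).congr' ?_
    filter_upwards [eventually_mem_box x] with m hm
    rw [if_pos hm]
  · split_ifs
    · exact hb m x
    · rw [norm_zero]
      exact (abs_nonneg _).trans (hb m x)

lemma continuous_boxError (P Q : ℝ) (m : ℕ) (x : ℤ) :
    Continuous fun t => boxError ρ P Q m t x := by
  have h1 : Continuous fun t => boxTwoPoint ρ P Q m t x := continuous_pairing_semigroup ρ _ _ _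
  have h2 : Continuous fun t => boxBondCorr ρ P Q m t x := continuous_pairing_semigroup ρ _ _ _
  have h3 : Continuous fun t => boxBondCorr' ρ Q P m t (-x) :=
    continuous_pairing_semigroup ρ _ _ _
  unfold boxError
  split_ifs <;> fun_prop

lemma tendsto_integral_boxError (hP : 0 ≤ P) (hQ : 0 ≤ Q) (hPQ : P + Q = 1) {r t : ℝ} (hr : 0 ≤ r)
    (hrt : r ≤ t) : Tendsto (fun m => ∫ s in r..t, ∑ x ∈ box m, boxError ρ P Q m s x) atTop
      (𝓝 0) := by
  have hs : Summable fun x : ℤ => 12 * Real.exp (2 * t) * (1 + t) * ((1 + |(x : ℝ)|) ^ 2 * decay x) :=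
    summable_sq_mul_decay.mul_left _
  have h := intervalIntegral.tendsto_integral_filter_of_dominated_convergence (μ := volume)
    (F := fun m s => ∑ x ∈ box m, boxError ρ P Q m s x) (f := fun _ => 0) (a := r) (b := t)
    (l := atTop)
    (fun _ => ∑' x : ℤ, 12 * Real.exp (2 * t) * (1 + t) * ((1 + |(x : ℝ)|) ^ 2 * decay x))
    (Eventually.of_forall fun m =>
      (continuous_finsetSum _ fun x _ => continuous_boxError ρ P Q m x).aestronglyMeasurable)
    (Eventually.of_forall fun m => Eventually.of_forall fun s hst => ?_)
    intervalIntegrable_const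
    (Eventually.of_forall fun s hst => ?_)
  · simpa using h
  · rw [Set.uIoc_of_le hrt] at hst
    refine (norm_sum_le _ _).trans ?_
    refine (Finset.sum_le_sum fun x _ =>
      abs_boxError_le ρ hP hQ hPQ m (hr.trans hst.1.le) hst.2 x).trans ?_
    refine hs.sum_le_tsum _ fun x _ => ?_
    have := decay_pos x
    have := hr.trans hrt
    positivity
  · rw [Set.uIoc_of_le hrt] at hst
    have := tendsto_sum_box hs (fun m x =>
      abs_boxError_le ρ hP hQ hPQ m (hr.trans hst.1.le) hst.2 x)
      (tendsto_boxError ρ hP hQ hPQ (hr.trans hst.1.le))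
    simpa using this

/-- The second moment of the finite system increases up to a small error. -/
lemma integral_boxError_le_sub (hP : 0 ≤ P) (hQ : 0 ≤ Q) (hPQ : P + Q = 1) {m : ℕ} (hm : 1 ≤ m)
    {r t : ℝ} (hr : 0 ≤ r) (hrt : r ≤ t) :
    ∫ s in r..t, ∑ x ∈ box m, boxError ρ P Q m s x ≤
      ∑ x ∈ box m, ((x : ℝ) - (1 - 2 * ρ) * (P - Q) * t) ^ 2 * boxTwoPoint ρ P Q m t x -
      ∑ x ∈ box m, ((x : ℝ) - (1 - 2 * ρ) * (P - Q) * r) ^ 2 * boxTwoPoint ρ P Q m r x := by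
  have hE : Continuous fun s => ∑ x ∈ box m, boxError ρ P Q m s x :=
    continuous_finsetSum _ fun x _ => continuous_boxError ρ P Q m x
  have hc : ∀ x, Continuous fun s => boxBondCorr' ρ Q P m s x := fun x =>
    continuous_pairing_semigroup ρ _ _ _
  have hD : Continuous fun s => (ρ : ℝ) * (1 - ρ) +
      2 * ((P - Q) * ∑ x ∈ box m, x * boxBondCorr' ρ Q P m s x) +
      ∑ x ∈ box m, boxError ρ P Q m s x := by
    fun_prop
  rw [← intervalIntegral.integral_eq_sub_of_hasDerivAt
    (fun s _ => hasDerivAt_sum_boxTwoPoint ρ hPQ m s) (hD.intervalIntegrable _ _)]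
  refine intervalIntegral.integral_mono_on hrt (hE.intervalIntegrable _ _)
    (hD.intervalIntegrable _ _) fun s hs => ?_
  -- The derivative exceeds the error by χ plus twice the signed drift term, both non-negative.
  have h1 := sum_mul_boxBondCorr'_nonneg ρ hP hQ hPQ hm (hr.trans hs.1)
  have h2 := chi_nonneg ρ
  linarith

end Limit

/-! ### The second moment of the infinite system -/

section Diffusivity

variable {Ω : Type*} [MeasurableSpace Ω] {P : Measure Ω} [IsProbabilityMeasure P]
  {ℱ : Filtration ℝ≥0 (inferInstance : MeasurableSpace Ω)} {p : ℤ → ℝ} {ρ : unitInterval}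
  {η : ℝ≥0 → Ω → Config}

lemma abs_twoPoint_le (hη : IsStationaryExclusion P ℱ p ρ η) (hp : IsJumpLaw p)
    (hnn : ∀ z : ℤ, |z| ≠ 1 → p z = 0) (x : ℤ) (t : ℝ≥0) :
    |twoPoint P ρ η x t| ≤ Real.exp (2 * t) * decay x :=
  le_of_tendsto (tendsto_twoPoint hη hp hnn x t).abs (Eventually.of_forall fun m =>
    abs_boxTwoPoint_le ρ (hp.nonneg _) (hp.nonneg _) (jump_add_eq_one hp hnn) m t.coe_nonneg x)

lemma abs_sq_mul_le (c : ℝ) (x : ℤ) {y E : ℝ} (hy : |y| ≤ E * decay x) :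
    |((x : ℝ) - c) ^ 2 * y| ≤ (1 + |c|) ^ 2 * E * ((1 + |(x : ℝ)|) ^ 2 * decay x) := by
  have h1 : |(x : ℝ) - c| ≤ (1 + |c|) * (1 + |(x : ℝ)|) := by
    have := abs_sub (x : ℝ) c
    nlinarith [abs_nonneg (x : ℝ), abs_nonneg c]
  rw [abs_mul, abs_pow]
  calc _ ≤ ((1 + |c|) * (1 + |(x : ℝ)|)) ^ 2 * (E * decay x) := by gcongr
    _ = _ := by ring

lemma summable_sq_mul_twoPoint (hη : IsStationaryExclusion P ℱ p ρ η) (hp : IsJumpLaw p)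
    (hnn : ∀ z : ℤ, |z| ≠ 1 → p z = 0) (c : ℝ) (t : ℝ≥0) :
    Summable fun x : ℤ => ((x : ℝ) - c) ^ 2 * twoPoint P ρ η x t :=
  Summable.of_norm_bounded (summable_sq_mul_decay.mul_left _) fun x =>
    abs_sq_mul_le c x (abs_twoPoint_le hη hp hnn x t)

lemma tendsto_sum_boxTwoPoint (hη : IsStationaryExclusion P ℱ p ρ η) (hp : IsJumpLaw p)
    (hnn : ∀ z : ℤ, |z| ≠ 1 → p z = 0) (c : ℝ) (t : ℝ≥0) :
    Tendsto (fun m => ∑ x ∈ box m, ((x : ℝ) - c) ^ 2 * boxTwoPoint ρ (p 1) (p (-1)) m t x) atTop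
      (𝓝 (∑' x : ℤ, ((x : ℝ) - c) ^ 2 * twoPoint P ρ η x t)) :=
  tendsto_sum_box (summable_sq_mul_decay.mul_left _) (fun m x => abs_sq_mul_le c x
    (abs_boxTwoPoint_le ρ (hp.nonneg _) (hp.nonneg _) (jump_add_eq_one hp hnn) m t.coe_nonneg x))
    fun x => (tendsto_twoPoint hη hp hnn x t).const_mul _

/-- Both second moments are limits of box quantities, and the lower bound for their difference in a
box tends to 0. -/
lemma monotone_tsum_sq_mul_twoPoint (hη : IsStationaryExclusion P ℱ p ρ η) (hp : IsJumpLaw p)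
    (hnn : ∀ z : ℤ, |z| ≠ 1 → p z = 0) : Monotone fun t : ℝ≥0 =>
      ∑' x : ℤ, ((x : ℝ) - (1 - 2 * ρ) * drift p * t) ^ 2 * twoPoint P ρ η x t := by
  intro r t hrt
  have hrt' : (r : ℝ) ≤ t := hrt
  have hPQ := jump_add_eq_one hp hnn
  have h1 := (tendsto_sum_boxTwoPoint hη hp hnn ((1 - 2 * ρ) * drift p * t) t).sub
    (tendsto_sum_boxTwoPoint hη hp hnn ((1 - 2 * ρ) * drift p * r) r)
  have h2 := tendsto_integral_boxError ρ (hp.nonneg 1) (hp.nonneg (-1)) hPQ r.coe_nonneg hrt'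
  refine sub_nonneg.1 (le_of_tendsto_of_tendsto h2 h1 ?_)
  filter_upwards [eventually_ge_atTop 1] with m hm
  rw [drift_eq hnn]
  exact integral_boxError_le_sub ρ (hp.nonneg 1) (hp.nonneg (-1)) hPQ hm r.coe_nonneg hrt'

lemma twoPoint_zero (hη : IsStationaryExclusion P ℱ p ρ η) (hp : IsJumpLaw p)
    (hnn : ∀ z : ℤ, |z| ≠ 1 → p z = 0) {x : ℤ} (hx : x ≠ 0) : twoPoint P ρ η x 0 = 0 := by
  refine tendsto_nhds_unique (tendsto_twoPoint hη hp hnn x 0) ?_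
  simp only [NNReal.coe_zero, semigroup_zero, pairing_centered_centered, if_neg hx]
  exact tendsto_const_nhds

end Diffusivity

end ExclusionProcess

theorem proposition3p3 {Ω : Type*} [MeasurableSpace Ω] (P : Measure Ω) [IsProbabilityMeasure P]
    (ℱ : Filtration ℝ≥0 (inferInstance : MeasurableSpace Ω))
    (p : ℤ → ℝ) (hp : ExclusionProcess.IsJumpLaw p) (hdrift : ExclusionProcess.drift p ≠ 0)
    (hnn : ∀ z : ℤ, |z| ≠ 1 → p z = 0)
    (ρ : unitInterval) (hρ0 : 0 < (ρ : ℝ)) (hρ1 : (ρ : ℝ) < 1)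
    (η : ℝ≥0 → Ω → ExclusionProcess.Config)
    (hη : ExclusionProcess.IsStationaryExclusion P ℱ p ρ η) :
    (∀ t : ℝ≥0, Summable fun x : ℤ =>
      ((x : ℝ) - (1 - 2 * (ρ : ℝ)) * ExclusionProcess.drift p * t) ^ 2 *
        ExclusionProcess.twoPoint P ρ η x t) ∧
    Monotone fun t : ℝ≥0 => (t : ℝ) * ExclusionProcess.diffusivity P p ρ η t := by
  refine ⟨fun t => ExclusionProcess.summable_sq_mul_twoPoint hη hp hnn _ t, ?_⟩
  have hmono := ExclusionProcess.monotone_tsum_sq_mul_twoPoint hη hp hnn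
  set V : ℝ≥0 → ℝ := fun t => ∑' x : ℤ, ((x : ℝ) - (1 - 2 * (ρ : ℝ)) *
    ExclusionProcess.drift p * t) ^ 2 * ExclusionProcess.twoPoint P ρ η x t with hV
  have hχ : 0 < (ρ : ℝ) * (1 - ρ) := mul_pos hρ0 (by linarith)
  have hV0 : V 0 = 0 := by
    simp only [hV]
    refine (tsum_congr fun x => ?_).trans tsum_zero
    by_cases hx : x = 0
    · subst hx; simp
    · rw [ExclusionProcess.twoPoint_zero hη hp hnn hx, mul_zero]
  -- At t = 0 the left side is 0 whatever the value of `diffusivity` there, and this agrees with the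
  -- right side because S(x, 0) is supported at x = 0, where the weight vanishes.
  have key : ∀ t : ℝ≥0, (t : ℝ) * ExclusionProcess.diffusivity P p ρ η t =
      ((ρ : ℝ) * (1 - ρ))⁻¹ * V t := by
    intro t
    rcases eq_or_ne t 0 with rfl | ht
    · rw [hV0]; simp
    · have ht' : (t : ℝ) ≠ 0 := by exact_mod_cast ht
      rw [ExclusionProcess.diffusivity, mul_inv, ← mul_assoc, mul_left_comm,
        mul_inv_cancel₀ ht', mul_one]
  intro r t hrt
  simp only [key]
  exact mul_le_mul_of_nonneg_left (hmono hrt) (inv_nonneg.2 hχ.le)
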